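/- **Conventions.** A partial group $L$ is a set with a set $D(L)$ of multipliable words (containing all one-letter words and closed under taking initial and final subwords), a product $\Pi\colon D(L)\to L$ with $\Pi(x)=x$ and such that $u\circ v\circ w\in D(L)$ implies $u\circ\Pi(v)\circ w\in D(L)$ with the same product, and an involutory inversion such that $u\in D(L)$ implies $u^{-1}\circ u\in D(L)$ and $\Pi(u^{-1}\circ u)=1:=\Pi(\emptyset)$. A subgroup is a non-empty subset $H$ closed under inversion, all of whose words are in $D(L)$ and have product in $H$; a $p$-subgroup is a finite subgroup of $p$-power order. Write ${}^{u}x=\Pi(u,x,u^{-1})$ when $(u,x,u^{-1})\in D(L)$; writing ${}^{u}H$ includes the assumption that ${}^{u}x$ is defined for all $x\in H$. For a collection $\Delta$ of subgroups, $D_\Delta$ is the set of words $(u_1,\dots,u_n)$ for which there are $H_0,\dots,H_n\in\Delta$ with ${}^{u_i}H_i=H_{i-1}$ for all $i$. A locality (for a prime $p$) is a triple $(L,\Delta,S)$ with $L$ a finite partial group, $S$ a $p$-subgroup of $L$ that is maximal among $p$-subgroups, and $\Delta\ni S$ a collection of subgroups of $S$ such that (O1) $D(L)=D_\Delta$, and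 (O2) if $X,Z\in\Delta$, $Y\le Z$ is a subgroup and $u\in L$ satisfies ${}^{u}X\subseteq Y$, then $N_Y({}^{u}X)\in\Delta$. The normalizer $N(L)$ is the set of $\eta\in L$ such that ${}^{\eta}x$ is defined for all $x\in L$, $x\mapsto{}^{\eta}x$ is an automorphism of $L$, and for all $(x_1,\dots,x_n)\in D(L)$ the words $({}^{\eta}x_1,\dots,{}^{\eta}x_i,\eta,x_{i+1},\dots,x_n)$, $0\le i\le n$, lie in $D(L)$ and have the same product. $\mathrm{Out}(L)=\mathrm{Aut}(L)/\mathrm{Inn}(L)$, where $\mathrm{Inn}(L)$ consists of the conjugations by elements of $N(L)$. **Extensions.** Let $L',L''$ be partial groups. A twisting pair consists of automorphisms $\Psi_g\in\mathrm{Aut}(L')$ ($g\in L''$) and elements $\eta(g,h)\in N(L')$ ($(g,h)\in D(L'')$) with $\Psi_1=\mathrm{id}$, $\eta(1,g)=1=\eta(g,1)$, ${}^{\eta(g,h)}\Psi_{gh}(x)=\Psi_g(\Psi_h(x))$, and $\Psi_g(\eta(h,k))\,\eta(g,hk)=\eta(g,h)\,\eta(gh,k)$ for $(g,h,k)\in D(L'')$.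 The corresponding extension $L'\xrightarrow{\iota}L\xrightarrow{\tau}L''$ is the partial group $L=L'\times L''$ in which $((x_1,g_1),\dots,(x_n,g_n))$ is multipliable iff $(g_1,\dots,g_n)\in D(L'')$ and $$\bigl(x_1,\ \Psi_{g_1}(x_2)\eta(g_1,g_2),\ \dots,\ \Psi_{g_1\cdots g_{n-1}}(x_n)\eta(g_1\cdots g_{n-1},g_n)\bigr)\in D(L'),$$ the product being the pair of the products of these two words; so $(x,g)(y,h)=(x\,\Psi_g(y)\,\eta(g,h),\,gh)$ and $(x,g)^{-1}=(\eta(g^{-1},g)^{-1}\Psi_{g^{-1}}(x^{-1}),g^{-1})$. Here $\iota(x)=(x,1)$ and $\tau(x,g)=g$. If $(L',\Delta',S')$ and $(L'',\Delta'',S'')$ are localities, the extension is isotypical if the class of every $\Psi_g$ in $\mathrm{Out}(L')$ is represented by an element of $\mathrm{Aut}(L';S')=\{\Phi\in\mathrm{Aut}(L')\mid\Phi(S')=S'\}$, and $\Phi(P)\in\Delta'$ for all $P\in\Delta'$ and $\Phi\in\mathrm{Aut}(L';S')$. **Proposition.** Let $p$ be a prime, let $(L',\Delta',S')$ and $(L'',\Delta'',S'')$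 be localities for $p$, and let $L'\xrightarrow{\iota}L\xrightarrow{\tau}L''$ be an isotypical extension. Let $S\le L$ be a $p$-subgroup such that $\iota$ and $\tau$ restrict to an extension $S'\to S\to S''$, that is, $\iota^{-1}(S)=S'$ and $\tau(S)=S''$. Put $$\Delta=\{P\le S\mid P\cap S'\in\Delta',\ \tau(P)\in\Delta''\},$$ where $P\cap S'=\{x\in S'\mid\iota(x)\in P\}$, and let $D_\Delta$ be formed in $L$. Then $D_\Delta\subseteq D(L)$; the set $T=\{f\in L\mid(f)\in D_\Delta\}$, with $D_\Delta$ as its set of multipliable words and with the product and inversion of $L$, is a partial group containing $S$; and $(T,\Delta,S)$ is a locality. -/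

import Mathlib

/-- A partial group on the set `M`: the set `D` of multipliable words, the product, and the
inversion. Only the values of `prod` on words in `D` are meaningful. -/
structure PartialGroup (M : Type*) where
  D : Set (List M)
  prod : List M → M
  inv : M → M
  singleton_mem : ∀ x, [x] ∈ D
  of_append : ∀ u v, u ++ v ∈ D → u ∈ D ∧ v ∈ D
  prod_singleton : ∀ x, prod [x] = x
  prod_append : ∀ u v w, u ++ v ++ w ∈ D →
    u ++ [prod v] ++ w ∈ D ∧ prod (u ++ [prod v] ++ w) = prod (u ++ v ++ w)
  inv_inv : ∀ x, inv (inv x) = x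
  inv_append : ∀ u ∈ D, (u.map inv).reverse ++ u ∈ D ∧
    prod ((u.map inv).reverse ++ u) = prod []

namespace PartialGroup

variable {M : Type*} (G : PartialGroup M)

/-- The unit, the product of the empty word. -/
def one : M := G.prod []

/-- The binary product `x · y`, meaningful when `[x, y] ∈ G.D`. -/
def mul (x y : M) : M := G.prod [x, y]

/-- The inverse word. -/
def invWord (u : List M) : List M := (u.map G.inv).reverse

/-- Left conjugation `u · x · u⁻¹`, meaningful when `[u, x, u⁻¹] ∈ G.D`. -/
def conj (u x : M) : M := G.prod [u, x, G.inv u]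

/-- Automorphisms of a partial group: bijections which, together with their inverse, preserve
multipliable words and their products. -/
structure Aut extends M ≃ M where
  map_mem_iff : ∀ w : List M, w.map toEquiv ∈ G.D ↔ w ∈ G.D
  map_prod : ∀ w ∈ G.D, toEquiv (G.prod w) = G.prod (w.map toEquiv)

instance : CoeFun (Aut G) (fun _ => M → M) := ⟨fun f => f.toEquiv⟩

/-- The normalizer `N(M)` of a partial group. -/
def normalizer : Set M :=
  {n | (∀ x, [n, x, G.inv n] ∈ G.D) ∧ (∃ α : Aut G, ∀ x, α x = G.conj n x) ∧
    ∀ u v, u ++ v ∈ G.D → u.map (G.conj n) ++ n :: v ∈ G.D ∧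
      G.prod (u.map (G.conj n) ++ n :: v) = G.prod (n :: (u ++ v))}

/-- Two automorphisms have the same class in `Out(M) = Aut(M) / Inn(M)`; the inner automorphisms
are the left conjugations by elements of the normalizer. -/
def SameOuterClass (Φ Ψ : Aut G) : Prop := ∃ n ∈ G.normalizer, ∀ x, Φ x = G.conj n (Ψ x)

/-- `H` is a subgroup of the partial group: every word in `H` is multipliable, and `H` is
closed under products and inversion. -/
structure IsSubgroup (H : Set M) : Prop where
  nonempty : H.Nonempty
  inv_mem : ∀ x ∈ H, G.inv x ∈ H
  word_mem : ∀ w : List M, (∀ x ∈ w, x ∈ H) → w ∈ G.D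
  prod_mem : ∀ w : List M, (∀ x ∈ w, x ∈ H) → G.prod w ∈ H

/-- A (finite) `p`-subgroup of the partial group. -/
structure IsPSubgroup (p : ℕ) (H : Set M) : Prop extends G.IsSubgroup H where
  card_eq : ∃ k : ℕ, H.ncard = p ^ k

/-- All conjugates `u · x · u⁻¹` with `x ∈ X` are defined. -/
def Conjugable (u : M) (X : Set M) : Prop := ∀ x ∈ X, [u, x, G.inv u] ∈ G.D

/-- `N_Y(A)`. -/
def normalizerIn (Y A : Set M) : Set M :=
  {y ∈ Y | G.Conjugable y A ∧ G.conj y '' A ⊆ A}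

/-- `w = (u₁, …, uₙ)` conjugates a chain `H = H₀, H₁, …, Hₙ` of members of `Δ`, in the sense that
`uᵢ Hᵢ uᵢ⁻¹ = Hᵢ₋₁` for `i = 1, …, n`. -/
def ConjugatesChain (Δ : Set (Set M)) : List M → Set M → Prop
  | [], H => H ∈ Δ
  | u :: w, H => H ∈ Δ ∧
      ∃ K, G.Conjugable u K ∧ G.conj u '' K = H ∧ ConjugatesChain Δ w K

/-- The set of words `D_Δ`. -/
def chainWords (Δ : Set (Set M)) : Set (List M) := {w | ∃ H, G.ConjugatesChain Δ w H}

/-- `(M, Δ)` is an objective partial group. -/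
structure IsObjective (Δ : Set (Set M)) : Prop where
  isSubgroup : ∀ P ∈ Δ, G.IsSubgroup P
  domain_eq : G.D = G.chainWords Δ
  normalizerIn_mem : ∀ X ∈ Δ, ∀ Z ∈ Δ, ∀ Y, G.IsSubgroup Y → Y ⊆ Z → ∀ u,
    G.Conjugable u X → G.conj u '' X ⊆ Y → G.normalizerIn Y (G.conj u '' X) ∈ Δ

/-- `(M, Δ, S)` is a locality. -/
structure IsLocality (p : ℕ) (Δ : Set (Set M)) (S : Set M) : Prop where
  finite : Finite M
  isPSubgroup : G.IsPSubgroup p S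
  subset : ∀ P ∈ Δ, P ⊆ S
  mem : S ∈ Δ
  isObjective : G.IsObjective Δ
  maximal : ∀ Q, G.IsPSubgroup p Q → S ⊆ Q → Q = S

/-- `T` is the partial group contained in `G` whose set of multipliable words is `W ⊆ G.D`, its
elements being the one-letter words in `W`, with the product and inversion of `G`. -/
structure IsRestriction (W : Set (List M)) (T : PartialGroup {f : M // [f] ∈ W}) : Prop where
  subset : W ⊆ G.D
  mem_iff : ∀ w : List {f : M // [f] ∈ W}, w ∈ T.D ↔ w.map Subtype.val ∈ W
  letters : ∀ w ∈ W, ∀ f ∈ w, [f] ∈ W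
  prod_eq : ∀ w ∈ T.D, (T.prod w : M) = G.prod (w.map Subtype.val)
  inv_eq : ∀ f, (T.inv f : M) = G.inv f

/-! ### Elementary facts -/

theorem nil_mem : [] ∈ G.D := (G.of_append [] [G.one] (G.singleton_mem _)).1

theorem left_mem {u v : List M} (h : u ++ v ∈ G.D) : u ∈ G.D := (G.of_append u v h).1

theorem right_mem {u v : List M} (h : u ++ v ∈ G.D) : v ∈ G.D := (G.of_append u v h).2

theorem cons_left {a : M} {v : List M} (h : a :: v ∈ G.D) : v ∈ G.D :=
  G.right_mem (u := [a]) h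

/-- Merging a subword. -/
theorem merge (u v w : List M) (h : u ++ (v ++ w) ∈ G.D) :
    u ++ G.prod v :: w ∈ G.D ∧ G.prod (u ++ G.prod v :: w) = G.prod (u ++ (v ++ w)) := by
  have := G.prod_append u v w (by simpa using h)
  simpa using this

theorem merge_head (v w : List M) (h : v ++ w ∈ G.D) :
    G.prod v :: w ∈ G.D ∧ G.prod (G.prod v :: w) = G.prod (v ++ w) := by
  simpa using G.merge [] v w (by simpa using h)

theorem insert_one (u w : List M) (h : u ++ w ∈ G.D) :
    u ++ G.one :: w ∈ G.D ∧ G.prod (u ++ G.one :: w) = G.prod (u ++ w) := by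
  simpa [one] using G.merge u [] w (by simpa using h)

theorem invWord_invWord (u : List M) : G.invWord (G.invWord u) = u := by
  simp only [invWord, List.map_reverse, List.reverse_reverse, List.map_map]
  conv_rhs => rw [← List.map_id u]
  exact List.map_congr_left fun x _ => G.inv_inv x

theorem invWord_mem {u : List M} (h : u ∈ G.D) : G.invWord u ∈ G.D :=
  G.left_mem (G.inv_append u h).1

/-- `u ++ v ∈ D` implies `u⁻¹ ++ u ++ v ∈ D`, with product that of `v`. -/
theorem cancel_left (u v : List M) (h : u ++ v ∈ G.D) :
    G.invWord u ++ (u ++ v) ∈ G.D ∧ G.prod (G.invWord u ++ (u ++ v)) = G.prod v := by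
  have h1 := (G.inv_append _ h).1
  have h2 : G.invWord u ++ (u ++ v) ∈ G.D := by
    apply G.right_mem (u := G.invWord v)
    simpa [invWord] using h1
  refine ⟨h2, ?_⟩
  have hu := G.inv_append u (G.left_mem h)
  have h3 := G.merge_head (G.invWord u ++ u) v (by simpa using h2)
  have h4 := G.insert_one [] v (G.right_mem h)
  have h5 : G.prod (G.invWord u ++ u) = G.one := hu.2
  rw [h5] at h3
  have h6 := h3.2
  rw [List.append_assoc] at h6
  rw [← h6]
  simpa using h4.2

theorem cancel_right (u v : List M) (h : u ++ v ∈ G.D) :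
    u ++ (v ++ G.invWord v) ∈ G.D ∧ G.prod (u ++ (v ++ G.invWord v)) = G.prod u := by
  have h1 := (G.inv_append _ (G.invWord_mem h)).1
  have e : ((G.invWord (u ++ v)).map G.inv).reverse = u ++ v := G.invWord_invWord (u ++ v)
  rw [e] at h1
  have h2 : u ++ (v ++ G.invWord v) ∈ G.D := by
    apply G.left_mem (v := G.invWord u)
    simpa [invWord] using h1
  refine ⟨h2, ?_⟩
  have hv := G.inv_append _ (G.invWord_mem (G.right_mem h))
  have e' : ((G.invWord v).map G.inv).reverse = v := G.invWord_invWord v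
  rw [e'] at hv
  have h3 := G.merge u (v ++ G.invWord v) [] (by simpa using h2)
  have h5 : G.prod (v ++ G.invWord v) = G.one := hv.2
  have h4 := G.insert_one u [] (by simpa using G.left_mem h)
  rw [h5] at h3
  have h6 := h3.2
  rw [List.append_nil] at h6
  rw [← h6, h4.2, List.append_nil]

theorem inv_mul_pair (x : M) : [G.inv x, x] ∈ G.D ∧ G.mul (G.inv x) x = G.one :=
  G.inv_append [x] (G.singleton_mem x)

theorem mul_inv_pair (x : M) : [x, G.inv x] ∈ G.D ∧ G.mul x (G.inv x) = G.one := by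
  have := G.inv_mul_pair (G.inv x)
  rwa [G.inv_inv] at this

theorem one_mul (x : M) : G.mul G.one x = x := by
  have := (G.insert_one [] [x] (G.singleton_mem x)).2
  simpa [G.prod_singleton, mul] using this

theorem mul_one (x : M) : G.mul x G.one = x := by
  have := (G.insert_one [x] [] (by simpa using G.singleton_mem x)).2
  simpa [G.prod_singleton, mul] using this

theorem prod_cons (a : M) (w : List M) (h : a :: w ∈ G.D) :
    [a, G.prod w] ∈ G.D ∧ G.prod (a :: w) = G.mul a (G.prod w) := by
  have := G.merge [a] w [] (by simpa using h)
  simp only [List.append_nil] at this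
  exact ⟨this.1, this.2.symm⟩

theorem mul_assoc {a b c : M} (h : [a, b, c] ∈ G.D) :
    G.mul (G.mul a b) c = G.mul a (G.mul b c) := by
  have h1 := (G.merge_head [a, b] [c] h).2
  have h2 := (G.merge [a] [b, c] [] h).2
  exact h1.trans h2.symm

theorem eq_inv_of_mul_eq_one {a x : M} (h : [a, x] ∈ G.D) (h1 : G.mul a x = G.one) :
    a = G.inv x := by
  have h2 := G.cancel_right [a] [x] h
  have h3 := G.merge_head [a, x] [G.inv x] h2.1
  have h4 : G.prod [a, x] = G.one := h1
  have h5 := h3.2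
  rw [h4] at h5
  have h6 := h2.2
  rw [G.prod_singleton] at h6
  have h7 := G.one_mul (G.inv x)
  exact h6.symm.trans (h5.symm.trans h7)

theorem prod_invWord {w : List M} (h : w ∈ G.D) : G.prod (G.invWord w) = G.inv (G.prod w) := by
  have h1 := G.inv_append w h
  have h2 := G.merge_head (G.invWord w) w h1.1
  have h3 := G.merge [G.prod (G.invWord w)] w [] (by simpa using h2.1)
  refine G.eq_inv_of_mul_eq_one h3.1 ?_
  refine h3.2.trans ?_
  rw [List.append_nil]
  exact h2.2.trans h1.2

theorem inv_mul_rev {a b : M} (h : [a, b] ∈ G.D) :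
    G.inv (G.mul a b) = G.mul (G.inv b) (G.inv a) := by
  have h1 := G.inv_append [a, b] h
  have h1' : [G.inv b, G.inv a, a, b] ∈ G.D := h1.1
  have h2 := G.merge_head [G.inv b, G.inv a] [a, b] h1'
  have h3 := G.merge [G.mul (G.inv b) (G.inv a)] [a, b] [] h2.1
  refine (G.eq_inv_of_mul_eq_one h3.1 ?_).symm
  exact h3.2.trans (h2.2.trans h1.2)

namespace Aut

variable {G}

theorem mapMem (Φ : Aut G) {w : List M} (h : w ∈ G.D) : w.map Φ ∈ G.D :=
  (Φ.map_mem_iff w).2 h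

theorem map_mul (Φ : Aut G) {a b : M} (h : [a, b] ∈ G.D) :
    Φ (G.mul a b) = G.mul (Φ a) (Φ b) := Φ.map_prod _ h

theorem map_one (Φ : Aut G) : Φ G.one = G.one := Φ.map_prod [] G.nil_mem

theorem map_inv (Φ : Aut G) (x : M) : Φ (G.inv x) = G.inv (Φ x) := by
  have h := G.inv_mul_pair x
  refine G.eq_inv_of_mul_eq_one (Φ.mapMem h.1) ?_
  rw [← Φ.map_mul h.1, h.2, Φ.map_one]

theorem map_conj (Φ : Aut G) {n x : M} (h : [n, x, G.inv n] ∈ G.D) :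
    Φ (G.conj n x) = G.conj (Φ n) (Φ x) := by
  have := Φ.map_prod _ h
  simpa [conj, ← Φ.map_inv] using this

/-- The inverse automorphism. -/
def symm (Φ : Aut G) : Aut G where
  toEquiv := Φ.toEquiv.symm
  map_mem_iff w := by
    have := Φ.map_mem_iff (w.map Φ.toEquiv.symm)
    have e : (w.map Φ.toEquiv.symm).map Φ.toEquiv = w := by simp
    rw [← this]
    exact iff_of_eq (congrArg (· ∈ G.D) e)
  map_prod w h := by
    apply Φ.toEquiv.injective
    have e : (w.map Φ.toEquiv.symm).map Φ.toEquiv = w := by simp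
    have h1 : w.map Φ.toEquiv.symm ∈ G.D := by
      rw [← Φ.map_mem_iff]
      exact (congrArg (· ∈ G.D) e).mpr h
    have := Φ.map_prod _ h1
    refine Eq.trans ?_ this.symm
    refine (Φ.toEquiv.apply_symm_apply _).trans ?_
    exact congrArg G.prod e.symm

theorem apply_symm (Φ : Aut G) (x : M) : Φ (Φ.symm x) = x := Φ.toEquiv.apply_symm_apply x

theorem map_normalizer (Φ : Aut G) {n : M} (hn : n ∈ G.normalizer) : Φ n ∈ G.normalizer := by
  obtain ⟨h1, ⟨α, hα⟩, h3⟩ := hn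
  have hc : ∀ x, Φ (G.conj n x) = G.conj (Φ n) (Φ x) := fun x => Φ.map_conj (h1 x)
  refine ⟨fun x => ?_, ⟨⟨Φ.toEquiv.symm.trans (α.toEquiv.trans Φ.toEquiv), ?_, ?_⟩, ?_⟩, ?_⟩
  · have := Φ.mapMem (h1 (Φ.symm x))
    simpa [Φ.apply_symm, Φ.map_inv] using this
  · intro w
    have e : w.map (Φ.toEquiv.symm.trans (α.toEquiv.trans Φ.toEquiv)) =
      ((w.map Φ.symm).map α).map Φ := by simp [symm]
    have := (Φ.map_mem_iff ((w.map Φ.symm).map α)).trans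
      ((α.map_mem_iff (w.map Φ.symm)).trans (Φ.symm.map_mem_iff w))
    exact (iff_of_eq (congrArg (· ∈ G.D) e)).trans this
  · intro w hw
    have hw1 := Φ.symm.mapMem hw
    have hw2 := α.mapMem hw1
    have e : w.map (Φ.toEquiv.symm.trans (α.toEquiv.trans Φ.toEquiv)) =
      ((w.map Φ.symm).map α).map Φ := by simp [symm]
    have e1 : Φ.symm (G.prod w) = G.prod (w.map Φ.symm) := Φ.symm.map_prod w hw
    have e2 : α (G.prod (w.map Φ.symm)) = G.prod ((w.map Φ.symm).map α) := α.map_prod _ hw1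
    have e3 : Φ (G.prod ((w.map Φ.symm).map α)) = G.prod (((w.map Φ.symm).map α).map Φ) :=
      Φ.map_prod _ hw2
    calc _ = Φ (α (Φ.symm (G.prod w))) := rfl
      _ = G.prod (((w.map Φ.symm).map α).map Φ) := by rw [e1, e2, e3]
      _ = _ := congrArg G.prod e.symm
  · intro x
    have : Φ (α (Φ.symm x)) = G.conj (Φ n) x := by rw [hα, hc, Φ.apply_symm]
    exact this
  · intro u v huv
    have h4 := h3 (u.map Φ.symm) (v.map Φ.symm) (by simpa using Φ.symm.mapMem huv)
    have e0 : ∀ l : List M, (l.map Φ.symm).map Φ = l := fun l => by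
      rw [List.map_map]
      conv_rhs => rw [← List.map_id l]
      exact List.map_congr_left fun x _ => Φ.apply_symm x
    have e1 : ((u.map Φ.symm).map (G.conj n) ++ n :: v.map Φ.symm).map Φ =
        u.map (G.conj (Φ n)) ++ Φ n :: v := by
      rw [List.map_append, List.map_cons, e0]
      congr 1
      rw [List.map_map, List.map_map]
      refine List.map_congr_left fun x _ => ?_
      simp only [Function.comp_apply]
      rw [hc, Φ.apply_symm]
    have e2 : (n :: (u.map Φ.symm ++ v.map Φ.symm)).map Φ = Φ n :: (u ++ v) := by
      rw [List.map_cons, List.map_append, e0, e0]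
    have h5 := h3 [] (u.map Φ.symm ++ v.map Φ.symm) (by simpa using Φ.symm.mapMem huv)
    refine ⟨e1 ▸ Φ.mapMem h4.1, ?_⟩
    rw [← e1, ← e2]
    have a1 : Φ _ = _ := Φ.map_prod _ h4.1
    have a2 : Φ _ = _ := Φ.map_prod _ h5.1
    rw [List.map_nil, List.nil_append] at a2
    rw [← a1, ← a2, h4.2]

end Aut

variable {G}

section Normalizer

variable {n : M}

theorem cons_mem (hn : n ∈ G.normalizer) {w : List M} (h : w ∈ G.D) : n :: w ∈ G.D := by
  simpa using (hn.2.2 [] w h).1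

theorem conj_conj (hn : n ∈ G.normalizer) (x : M) : G.conj (G.inv n) (G.conj n x) = x := by
  have h := hn.1 x
  have h1 := G.cancel_right [n, x] [G.inv n] h
  have e : G.invWord [G.inv n] = [n] := by simp [invWord, G.inv_inv]
  rw [e] at h1
  have h1' : [n, x, G.inv n, n] ∈ G.D := h1.1
  have h2 := G.cancel_left [n] [x, G.inv n, n] h1'
  have h2' : [G.inv n, n, x, G.inv n, n] ∈ G.D := h2.1
  have h3 := (G.merge [G.inv n] [n, x, G.inv n] [n] h2').2
  have h4 := G.cancel_right [x] [G.inv n] (G.cons_left h)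
  rw [e] at h4
  have h5 : G.conj (G.inv n) (G.conj n x) = G.prod [G.inv n, G.prod [n, x, G.inv n], n] := by
    simp [conj, G.inv_inv]
  rw [h5]
  refine h3.trans (h2.2.trans ?_)
  exact h4.2.trans (G.prod_singleton x)

theorem map_conj_mem (hn : n ∈ G.normalizer) (w : List M) :
    w.map (G.conj n) ∈ G.D ↔ w ∈ G.D := by
  obtain ⟨α, hα⟩ := hn.2.1
  rw [← α.map_mem_iff w]
  have : w.map (G.conj n) = w.map α := List.map_congr_left fun x _ => (hα x).symm
  rw [this]

theorem exists_conj (hn : n ∈ G.normalizer) (x : M) : ∃ y, G.conj n y = x := by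
  obtain ⟨α, hα⟩ := hn.2.1
  exact ⟨α.symm x, by rw [← hα, α.apply_symm]⟩

theorem conj_conj_inv (hn : n ∈ G.normalizer) (x : M) : G.conj n (G.conj (G.inv n) x) = x := by
  obtain ⟨y, rfl⟩ := exists_conj hn x
  rw [conj_conj hn]

theorem map_conj_conj (hn : n ∈ G.normalizer) (w : List M) :
    (w.map (G.conj (G.inv n))).map (G.conj n) = w := by
  rw [List.map_map]
  conv_rhs => rw [← List.map_id w]
  exact List.map_congr_left fun x _ => conj_conj_inv hn x

theorem append_mem (hn : n ∈ G.normalizer) {w : List M} (h : w ∈ G.D) : w ++ [n] ∈ G.D := by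
  have h1 : w.map (G.conj (G.inv n)) ∈ G.D := by
    rw [← map_conj_mem hn, map_conj_conj hn]; exact h
  have := (hn.2.2 (w.map (G.conj (G.inv n))) [] (by simpa using h1)).1
  rwa [map_conj_conj hn] at this

theorem conj_mul (hn : n ∈ G.normalizer) (x : M) : G.mul (G.conj n x) n = G.mul n x := by
  have := (hn.2.2 [x] [] (by simpa using G.singleton_mem x)).2
  simpa [mul] using this

theorem conj_self (hn : n ∈ G.normalizer) : G.conj n n = n := by
  have h := G.merge [n] [n, G.inv n] [] (hn.1 n)
  have h1 : G.prod [n, G.inv n] = G.one := (G.mul_inv_pair n).2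
  rw [h1] at h
  exact h.2.symm.trans (G.mul_one n)

theorem inv_mem_normalizer (hn : n ∈ G.normalizer) : G.inv n ∈ G.normalizer := by
  obtain ⟨α, hα⟩ := hn.2.1
  have hs : ∀ x, α.symm x = G.conj (G.inv n) x := fun x => by
    apply α.toEquiv.injective
    refine (α.apply_symm x).trans ?_
    refine Eq.trans ?_ (hα _).symm
    exact (conj_conj_inv hn x).symm
  have hinv : ∀ x, G.inv (G.conj (G.inv n) x) = G.conj (G.inv n) (G.inv x) := fun x => by
    rw [← hs, ← hs, α.symm.map_inv]
  have e : ∀ u v, G.invWord (G.invWord v ++ n :: (G.invWord u).map (G.conj (G.inv n))) =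
      u.map (G.conj (G.inv n)) ++ G.inv n :: v := by
    intro u v
    have e1 : G.invWord ((G.invWord u).map (G.conj (G.inv n))) =
        u.map (G.conj (G.inv n)) := by
      simp only [invWord, List.map_reverse, List.reverse_reverse, List.map_map]
      refine List.map_congr_left fun x _ => ?_
      simp only [Function.comp_apply]
      rw [hinv, G.inv_inv]
    have e2 := G.invWord_invWord v
    have e3 : ∀ a b : List M, G.invWord (a ++ n :: b) =
      G.invWord b ++ G.inv n :: G.invWord a := fun a b => by simp [invWord]
    rw [e3, e1, e2]
  have hmem : ∀ u v, u ++ v ∈ G.D → u.map (G.conj (G.inv n)) ++ G.inv n :: v ∈ G.D ∧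
      G.prod (u.map (G.conj (G.inv n)) ++ G.inv n :: v) =
        G.inv (G.prod (n :: (G.invWord (u ++ v)).map (G.conj (G.inv n)))) := by
    intro u v h
    have h1 : G.invWord (u ++ v) ∈ G.D := G.invWord_mem h
    have h2 : (G.invWord (u ++ v)).map (G.conj (G.inv n)) ∈ G.D := by
      rw [← map_conj_mem hn, map_conj_conj hn]; exact h1
    have h3 := hn.2.2 ((G.invWord v).map (G.conj (G.inv n)))
      ((G.invWord u).map (G.conj (G.inv n))) (by simpa [invWord] using h2)
    rw [map_conj_conj hn] at h3
    rw [← e]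
    refine ⟨G.invWord_mem h3.1, ?_⟩
    rw [G.prod_invWord h3.1, h3.2]
    simp [invWord]
  refine ⟨fun x => ?_, ⟨α.symm, hs⟩, fun u v h => ⟨(hmem u v h).1, ?_⟩⟩
  · rw [G.inv_inv]
    exact append_mem hn (by simpa using (hmem [] [x] (G.singleton_mem x)).1)
  · have h2 := (hmem [] (u ++ v) h).2
    rw [List.map_nil, List.nil_append, List.nil_append] at h2
    rw [(hmem u v h).2, h2]

theorem mem_nx (hn : n ∈ G.normalizer) (x : M) : [n, x] ∈ G.D := cons_mem hn (G.singleton_mem x)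

theorem mem_xn (hn : n ∈ G.normalizer) (x : M) : [x, n] ∈ G.D := append_mem hn (G.singleton_mem x)

variable {m : M}

theorem mem_mnx (hm : m ∈ G.normalizer) (hn : n ∈ G.normalizer) (x : M) : [m, n, x] ∈ G.D :=
  cons_mem hm (mem_nx hn x)

theorem mem_mxn (hm : m ∈ G.normalizer) (hn : n ∈ G.normalizer) (x : M) : [m, x, n] ∈ G.D :=
  cons_mem hm (mem_xn hn x)

theorem mem_xmn (hm : m ∈ G.normalizer) (hn : n ∈ G.normalizer) (x : M) : [x, m, n] ∈ G.D :=
  append_mem hn (mem_xn hm x)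

theorem inv_mul_cancel (hn : n ∈ G.normalizer) (x : M) : G.mul (G.inv n) (G.mul n x) = x := by
  rw [← G.mul_assoc (mem_mnx (inv_mem_normalizer hn) hn x), (G.inv_mul_pair n).2, G.one_mul]

theorem mul_inv_cancel (hn : n ∈ G.normalizer) (x : M) : G.mul n (G.mul (G.inv n) x) = x := by
  rw [← G.mul_assoc (mem_mnx hn (inv_mem_normalizer hn) x), (G.mul_inv_pair n).2, G.one_mul]

theorem mul_mul_inv (hn : n ∈ G.normalizer) (x : M) : G.mul (G.mul x n) (G.inv n) = x := by
  rw [G.mul_assoc (mem_xmn hn (inv_mem_normalizer hn) x), (G.mul_inv_pair n).2, G.mul_one]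

theorem mul_inv_mul (hn : n ∈ G.normalizer) (x : M) : G.mul (G.mul x (G.inv n)) n = x := by
  rw [G.mul_assoc (mem_xmn (inv_mem_normalizer hn) hn x), (G.inv_mul_pair n).2, G.mul_one]

theorem insert_pair (hn : n ∈ G.normalizer) (u v : List M) (h : u ++ v ∈ G.D) :
    u ++ G.inv n :: n :: v ∈ G.D ∧ G.prod (u ++ G.inv n :: n :: v) = G.prod (u ++ v) := by
  have hm := inv_mem_normalizer hn
  have h1 := (hm.2.2 u v h).1
  have h2 := (hn.2.2 (u.map (G.conj (G.inv n)) ++ [G.inv n]) v (by simpa using h1)).1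
  have h3 : G.conj n (G.inv n) = G.inv n := by
    have := conj_conj_inv hn (G.inv n)
    rwa [conj_self hm] at this
  rw [List.map_append, map_conj_conj hn] at h2
  have h4 : u ++ G.inv n :: n :: v ∈ G.D := by simpa [h3] using h2
  refine ⟨h4, ?_⟩
  have h5 := (G.merge u [G.inv n, n] v h4).2
  have h6 : G.prod [G.inv n, n] = G.one := (G.inv_mul_pair n).2
  rw [h6, (G.insert_one u v h).2] at h5
  exact h5.symm

/-- The word `A` arises from `B` by replacing each letter `bᵢ` by `eᵢ₋₁ · bᵢ · eᵢ⁻¹`, with elements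
`eᵢ` of the normalizer. -/
inductive Gauge (G : PartialGroup M) : M → M → List M → List M → Prop
  | nil (e : M) : Gauge G e e [] []
  | cons {e f k a b : M} {A B : List M} : f ∈ G.normalizer → G.prod [e, b, G.inv f] = a →
      Gauge G f k A B → Gauge G e k (a :: A) (b :: B)

theorem Gauge.forward {e k : M} {A B : List M} (h : Gauge G e k A B) (U : List M)
    (hB : U ++ e :: B ∈ G.D) :
    U ++ (A ++ [k]) ∈ G.D ∧ G.prod (U ++ (A ++ [k])) = G.prod (U ++ e :: B) := by
  induction h generalizing U with
  | nil e => exact ⟨hB, rfl⟩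
  | @cons e f k a b A B hf ha _ ih =>
    have h1 := insert_pair hf (U ++ [e, b]) B (by simpa using hB)
    have h2 := G.merge U [e, b, G.inv f] (f :: B) (by simpa using h1.1)
    rw [ha] at h2
    have h3 := ih (U ++ [a]) (by simpa using h2.1)
    refine ⟨by simpa using h3.1, ?_⟩
    have e1 : U ++ (a :: A ++ [k]) = U ++ [a] ++ (A ++ [k]) := by simp
    have e2 : U ++ [a] ++ f :: B = U ++ a :: f :: B := by simp
    have e3 : U ++ ([e, b, G.inv f] ++ f :: B) = U ++ [e, b] ++ G.inv f :: f :: B := by simp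
    have e4 : U ++ [e, b] ++ B = U ++ e :: b :: B := by simp
    rw [e1, h3.2, e2, h2.2, e3, h1.2, e4]

theorem Gauge.symm {e k : M} {A B : List M} (h : Gauge G e k A B) (he : e ∈ G.normalizer) :
    Gauge G (G.inv e) (G.inv k) B A := by
  induction h with
  | nil e => exact Gauge.nil _
  | @cons e f k a b A B hf ha _ ih =>
    refine Gauge.cons (inv_mem_normalizer hf) ?_ (ih hf)
    rw [G.inv_inv]
    have h1 := insert_pair he [] [b] (G.singleton_mem b)
    have h2 := insert_pair hf [G.inv e, e, b] [] (by simpa using h1.1)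
    have h3 := G.merge [G.inv e] [e, b, G.inv f] [f] h2.1
    rw [ha] at h3
    refine h3.2.trans (h2.2.trans ?_)
    refine Eq.trans ?_ (G.prod_singleton b)
    exact h1.2

theorem Gauge.mem_of_mem {e k : M} {A B : List M} (h : Gauge G e k A B) (he : e ∈ G.normalizer)
    (hB : B ∈ G.D) : A ∈ G.D ∧ G.mul (G.prod A) k = G.mul e (G.prod B) := by
  have h0 := cons_mem he hB
  have h1 := h.forward [] h0
  have h2 := G.merge_head A [k] h1.1
  exact ⟨G.left_mem h1.1, h2.2.trans (h1.2.trans (G.prod_cons e B h0).2)⟩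

end Normalizer

end PartialGroup

/-- The data determining an extension of the partial group `Q` by the partial group `N`: a
twisting pair, consisting of automorphisms `Ψ_g = act g` of `N` and elements
`η(g, h) = cocycle g h` of the normalizer of `N`, the latter meaningful when `[g, h] ∈ Q.D`. -/
structure TwistingPair {F B : Type*} (N : PartialGroup F) (Q : PartialGroup B) where
  act : B → N.Aut
  cocycle : B → B → F
  cocycle_mem : ∀ g h, [g, h] ∈ Q.D → cocycle g h ∈ N.normalizer
  act_one : ∀ x, act Q.one x = x
  cocycle_one_left : ∀ g, cocycle Q.one g = N.one
  cocycle_one_right : ∀ g, cocycle g Q.one = N.one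
  conj_eq : ∀ g h, [g, h] ∈ Q.D → ∀ x,
    N.conj (cocycle g h) (act (Q.mul g h) x) = act g (act h x)
  cocycle_eq : ∀ g h k, [g, h, k] ∈ Q.D →
    N.mul (act g (cocycle h k)) (cocycle g (Q.mul h k)) =
      N.mul (cocycle g h) (cocycle (Q.mul g h) k)

namespace TwistingPair

open PartialGroup

variable {F B : Type*} {N : PartialGroup F} {Q : PartialGroup B} (E : TwistingPair N Q)

/-- The word `Ψ_g(x₁) · η(g, g₁), Ψ_{gg₁}(x₂) · η(gg₁, g₂), Ψ_{gg₁g₂}(x₃) · η(gg₁g₂, g₃), …`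
in `N`, for a word `(x₁, g₁), (x₂, g₂), …` of pairs. For `g = 1` its first letter is `x₁`. -/
def twist : B → List (F × B) → List F
  | _, [] => []
  | g, a :: w => N.mul (E.act g a.1) (E.cocycle g a.2) :: twist (Q.mul g a.2) w

/-- The base components of a word of pairs. -/
abbrev base (w : List (F × B)) : List B := w.map Prod.snd

/-- `(x, g)⁻¹ = (η(g⁻¹, g)⁻¹ · Ψ_{g⁻¹}(x⁻¹), g⁻¹)`. -/
def pairInv (a : F × B) : F × B :=
  (N.mul (N.inv (E.cocycle (Q.inv a.2) a.2)) (E.act (Q.inv a.2) (N.inv a.1)), Q.inv a.2)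

theorem one_mem (g : B) : [Q.one, g] ∈ Q.D := (Q.insert_one [] [g] (Q.singleton_mem g)).1

theorem mem_one (g : B) : [g, Q.one] ∈ Q.D := (Q.insert_one [g] [] (Q.singleton_mem g)).1

theorem one_mem_normalizer (_E : TwistingPair N Q) : N.one ∈ N.normalizer := by
  rw [← _E.cocycle_one_left Q.one]
  exact _E.cocycle_mem _ _ (one_mem _)

theorem twist_append (g : B) (u v : List (F × B)) (h : g :: base u ∈ Q.D) :
    E.twist g (u ++ v) = E.twist g u ++ E.twist (Q.prod (g :: base u)) v := by
  induction u generalizing g with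
  | nil => simp [twist, Q.prod_singleton]
  | cons a u ih =>
    have h1 := Q.merge_head [g, a.2] (base u) h
    have h2 := ih (Q.mul g a.2) h1.1
    have h3 : Q.prod (Q.mul g a.2 :: base u) = Q.prod (g :: base (a :: u)) := h1.2
    simp only [List.cons_append, twist, h2, h3]

/-- The basic commutation `η(g, h) · Ψ_{gh}(x) = Ψ_g(Ψ_h(x)) · η(g, h)`. -/
theorem act_act_mul {g h : B} (H : [g, h] ∈ Q.D) (x : F) :
    N.mul (E.act g (E.act h x)) (E.cocycle g h) =
      N.mul (E.cocycle g h) (E.act (Q.mul g h) x) := by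
  rw [← E.conj_eq g h H, conj_mul (E.cocycle_mem g h H)]

theorem gauge_twist (k h : B) (v : List (F × B)) (H : k :: h :: base v ∈ Q.D) :
    Gauge N (E.cocycle k h) (E.cocycle k (Q.prod (h :: base v)))
      ((E.twist h v).map (E.act k)) (E.twist (Q.mul k h) v) := by
  induction v generalizing h with
  | nil => simpa [twist, Q.prod_singleton] using Gauge.nil _
  | cons a v ih =>
    have h1 := Q.merge [k] [h, a.2] (base v) H
    have h2 := ih (Q.mul h a.2) h1.1
    have h3 := (Q.merge_head [h, a.2] (base v) (Q.cons_left H)).2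
    have m3 : [k, h, a.2] ∈ Q.D := Q.left_mem (v := base v) H
    have e1 : Q.mul k (Q.mul h a.2) = Q.mul (Q.mul k h) a.2 := (Q.mul_assoc m3).symm
    have m12 : [k, h] ∈ Q.D := Q.left_mem (v := [a.2]) m3
    have m23 : [h, a.2] ∈ Q.D := Q.cons_left m3
    have m1 : [k, Q.mul h a.2] ∈ Q.D := (Q.merge [k] [h, a.2] [] m3).1
    have m2 : [Q.mul k h, a.2] ∈ Q.D := (Q.merge_head [k, h] [a.2] m3).1
    have n1 := E.cocycle_mem _ _ m12
    have n2 := E.cocycle_mem _ _ m1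
    have n3 := E.cocycle_mem _ _ m2
    have n4 := E.cocycle_mem _ _ m23
    have n5 := (E.act k).map_normalizer n4
    have n6 := inv_mem_normalizer n2
    rw [e1] at h2
    have h3' : Q.prod (Q.mul h a.2 :: base v) = Q.prod (h :: base (a :: v)) := h3
    rw [h3'] at h2
    refine Gauge.cons n2 ?_ h2
    have w1 : [E.cocycle k h, N.mul (E.act (Q.mul k h) a.1) (E.cocycle (Q.mul k h) a.2),
      N.inv (E.cocycle k (Q.mul h a.2))] ∈ N.D := mem_mxn n1 n6 _
    have w2 := (N.merge_head [_, _] [_] w1).2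
    refine w2.symm.trans ?_
    change N.mul (N.mul _ _) _ = _
    rw [← N.mul_assoc (mem_mxn n1 n3 _), ← E.act_act_mul m12,
      N.mul_assoc (mem_xmn n1 n3 _), ← E.cocycle_eq _ _ _ m3,
      ← N.mul_assoc (mem_xmn n5 n2 _), mul_mul_inv n2, ← (E.act k).map_mul (mem_xn n4 _)]

theorem gauge_one (k : B) (v : List (F × B)) (H : k :: base v ∈ Q.D) :
    Gauge N N.one (E.cocycle k (Q.prod (base v)))
      ((E.twist Q.one v).map (E.act k)) (E.twist k v) := by
  have h1 := Q.insert_one [k] (base v) H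
  have h2 := E.gauge_twist k Q.one v h1.1
  have h3 := (Q.insert_one [] (base v) (Q.cons_left H)).2
  rw [E.cocycle_one_right, Q.mul_one] at h2
  have h3' : Q.prod (Q.one :: base v) = Q.prod (base v) := h3
  rwa [h3'] at h2

theorem twist_mem_iff (k : B) (v : List (F × B)) (H : k :: base v ∈ Q.D) :
    E.twist k v ∈ N.D ↔ E.twist Q.one v ∈ N.D := by
  have h := E.gauge_one k v H
  rw [← (E.act k).map_mem_iff (E.twist Q.one v)]
  refine ⟨fun h1 => (h.mem_of_mem E.one_mem_normalizer h1).1, fun h1 => ?_⟩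
  exact ((h.symm E.one_mem_normalizer).mem_of_mem
    (inv_mem_normalizer E.one_mem_normalizer) h1).1

theorem prod_twist (k : B) (v : List (F × B)) (H : k :: base v ∈ Q.D)
    (h : E.twist k v ∈ N.D) :
    N.mul (E.act k (N.prod (E.twist Q.one v))) (E.cocycle k (Q.prod (base v))) =
      N.prod (E.twist k v) := by
  have h1 := (E.gauge_one k v H).mem_of_mem E.one_mem_normalizer h
  have h2 : E.act k (N.prod (E.twist Q.one v)) = N.prod ((E.twist Q.one v).map (E.act k)) :=
    (E.act k).map_prod _ ((E.twist_mem_iff k v H).1 h)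
  rw [h2, h1.2, N.one_mul]

theorem twist_one_singleton (a : F × B) : E.twist Q.one [a] = [a.1] := by
  simp [twist, E.act_one, E.cocycle_one_left, N.mul_one]

/-- `Ψ_k(η(g⁻¹, g)) = η(k, g⁻¹) · η(k g⁻¹, g)`. -/
theorem act_cocycle_inv {k g : B} (H : [k, Q.inv g, g] ∈ Q.D) :
    E.act k (E.cocycle (Q.inv g) g) =
      N.mul (E.cocycle k (Q.inv g)) (E.cocycle (Q.mul k (Q.inv g)) g) := by
  rw [← E.cocycle_eq _ _ _ H, (Q.inv_mul_pair g).2, E.cocycle_one_right, N.mul_one]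

theorem pairInv_pairInv (a : F × B) : E.pairInv (E.pairInv a) = a := by
  obtain ⟨x, g⟩ := a
  have p1 := Q.inv_mul_pair g
  have p2 := Q.mul_inv_pair g
  have m3 : [g, Q.inv g, g] ∈ Q.D := by
    have := (Q.cancel_left [Q.inv g] [g] p1.1).1
    simpa [invWord, Q.inv_inv] using this
  have c := E.act_cocycle_inv m3
  rw [p2.2, E.cocycle_one_left, N.mul_one] at c
  have n1 := E.cocycle_mem _ _ p1.1
  have n2 := E.cocycle_mem _ _ p2.1
  have e1 : N.inv (N.mul (N.inv (E.cocycle (Q.inv g) g)) (E.act (Q.inv g) (N.inv x))) =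
      N.mul (E.act (Q.inv g) x) (E.cocycle (Q.inv g) g) := by
    rw [N.inv_mul_rev (mem_nx (inv_mem_normalizer n1) _), N.inv_inv, (E.act _).map_inv,
      N.inv_inv]
  have e2 := E.act_act_mul p2.1 x
  rw [p2.2, E.act_one] at e2
  simp only [pairInv]
  rw [Q.inv_inv, e1, (E.act g).map_mul (mem_xn n1 _), c, e2, inv_mul_cancel n2]

/-- The letters of an inverse word. -/
theorem twist_inverse_letter {k g : B} (H : [k, Q.inv g, g] ∈ Q.D) (x : F) :
    N.mul (E.act k (E.pairInv (x, g)).1) (E.cocycle k (Q.inv g)) =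
      N.inv (N.mul (E.act (Q.mul k (Q.inv g)) x) (E.cocycle (Q.mul k (Q.inv g)) g)) := by
  have m12 : [k, Q.inv g] ∈ Q.D := Q.left_mem (v := [g]) H
  have m2 : [Q.mul k (Q.inv g), g] ∈ Q.D := (Q.merge_head [k, Q.inv g] [g] H).1
  have n1 := E.cocycle_mem _ _ (Q.inv_mul_pair g).1
  have n2 := E.cocycle_mem _ _ m12
  have n3 := E.cocycle_mem _ _ m2
  have n1' := inv_mem_normalizer n1
  have n2' := inv_mem_normalizer n2
  have n3' := inv_mem_normalizer n3
  simp only [pairInv]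
  rw [(E.act k).map_mul (mem_nx n1' _), (E.act k).map_inv, E.act_cocycle_inv H,
    N.mul_assoc (mem_mxn (inv_mem_normalizer (E.act_cocycle_inv H ▸
      (E.act k).map_normalizer n1)) n2 _), E.act_act_mul m12, N.inv_mul_rev (mem_xn n3 _),
    N.mul_assoc (mem_mnx n3' n2' _), inv_mul_cancel n2, (E.act _).map_inv,
    N.inv_mul_rev (mem_xn n3 _)]

theorem twist_inverse (u : List (F × B)) (hu : base u ∈ Q.D) :
    E.twist Q.one ((u.map E.pairInv).reverse) =
      N.invWord (E.twist (Q.prod (Q.invWord (base u))) u) := by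
  induction u with
  | nil => simp [twist, invWord]
  | cons a u ih =>
    obtain ⟨x, g⟩ := a
    have hu' : base u ∈ Q.D := Q.cons_left hu
    have eb : base ((u.map E.pairInv).reverse) = Q.invWord (base u) := by
      simp [base, invWord, pairInv, Function.comp_def]
    have ei : Q.invWord (base ((x, g) :: u)) = Q.invWord (base u) ++ [Q.inv g] := by
      simp [base, invWord]
    have hm : Q.invWord (base u) ∈ Q.D := Q.invWord_mem hu'
    have d1 : Q.invWord (base u) ++ ([Q.inv g] ++ [g]) ∈ Q.D := by
      have h1 := (Q.inv_append _ hu).1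
      have h2 : Q.invWord (base ((x, g) :: u)) ++ ([g] ++ base u) ∈ Q.D := h1
      rw [ei, List.append_assoc] at h2
      have h3 : (Q.invWord (base u) ++ ([Q.inv g] ++ [g])) ++ base u ∈ Q.D := by
        simpa using h2
      exact Q.left_mem h3
    have d2 := Q.merge_head (Q.invWord (base u)) [Q.inv g, g] d1
    have d3 : Q.prod (Q.invWord (base ((x, g) :: u))) =
        Q.mul (Q.prod (Q.invWord (base u))) (Q.inv g) := by
      rw [ei]
      have := Q.merge_head (Q.invWord (base u)) [Q.inv g]
        (by simpa using Q.left_mem (v := [g]) (by simpa using d1))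
      exact this.2.symm
    have d4 : Q.mul (Q.mul (Q.prod (Q.invWord (base u))) (Q.inv g)) g =
        Q.prod (Q.invWord (base u)) := by
      rw [Q.mul_assoc d2.1, (Q.inv_mul_pair g).2, Q.mul_one]
    have d5 := Q.insert_one [] (Q.invWord (base u)) hm
    have d6 : Q.prod (Q.one :: Q.invWord (base u)) = Q.prod (Q.invWord (base u)) := d5.2
    rw [List.map_cons, List.reverse_cons, E.twist_append _ _ _ (by rw [eb]; exact d5.1), eb, d6,
      ih hu', d3]
    have e2 : ∀ (b : F) (l : List F), N.invWord (b :: l) = N.invWord l ++ [N.inv b] :=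
      fun b l => by simp [invWord]
    simp only [twist]
    rw [e2, d4, ← E.twist_inverse_letter d2.1]
    rfl

/-- The partial group `L` of the extension `N → L → Q` determined by a twisting pair. Its elements
are the pairs `(x, g)`; in particular
`(x, g) · (y, h) = (x · Ψ_g(y) · η(g, h), g · h)`. -/
def total : PartialGroup (F × B) where
  D := {w | base w ∈ Q.D ∧ E.twist Q.one w ∈ N.D}
  prod w := (N.prod (E.twist Q.one w), Q.prod (base w))
  inv := E.pairInv
  singleton_mem a := ⟨Q.singleton_mem _, by
    rw [E.twist_one_singleton]; exact N.singleton_mem _⟩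
  of_append u v h := by
    obtain ⟨h1, h2⟩ := h
    rw [base, List.map_append] at h1
    have h3 := (Q.insert_one [] _ h1).1
    have h4 : Q.one :: base u ∈ Q.D := Q.left_mem (v := base v) h3
    rw [E.twist_append _ _ _ h4] at h2
    refine ⟨⟨Q.left_mem h1, N.left_mem h2⟩, Q.right_mem h1, ?_⟩
    have h5 := Q.merge_head (Q.one :: base u) (base v) h3
    exact (E.twist_mem_iff _ _ h5.1).1 (N.right_mem h2)
  prod_singleton a := by
    rw [E.twist_one_singleton, N.prod_singleton, base, List.map_singleton, Q.prod_singleton]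
  prod_append u v w h := by
    obtain ⟨h1, h2⟩ := h
    have h1' : base u ++ (base v ++ base w) ∈ Q.D := by simpa using h1
    have b1 := (Q.insert_one [] _ h1').1
    have b1' : Q.one :: base u ++ (base v ++ base w) ∈ Q.D := b1
    have b2 : Q.one :: base u ∈ Q.D := Q.left_mem b1'
    have b3 := Q.merge_head (Q.one :: base u) (base v ++ base w) b1'
    have b4 : Q.prod (Q.one :: base u) :: base v ∈ Q.D := Q.left_mem (v := base w) b3.1
    have b5 := Q.merge (base u) (base v) (base w) h1'
    have b6 := Q.merge_head (Q.prod (Q.one :: base u) :: base v) (base w) b3.1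
    have b7 := Q.prod_cons _ _ b4
    have b8 := Q.merge (Q.one :: base u) (base v) (base w) b1'
    have b9 : [Q.prod (Q.one :: base u), Q.prod (base v)] ∈ Q.D := b7.1
    rw [List.append_assoc, E.twist_append _ _ _ b2, E.twist_append _ _ _ b4] at h2
    have c1 := E.prod_twist _ _ b4 (N.left_mem (N.right_mem h2))
    have c2 := N.merge _ _ _ h2
    have c3 : E.twist Q.one (u ++ [(N.prod (E.twist Q.one v), Q.prod (base v))] ++ w) =
        E.twist Q.one u ++ N.prod (E.twist (Q.prod (Q.one :: base u)) v) ::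
          E.twist (Q.prod (Q.prod (Q.one :: base u) :: base v)) w := by
      rw [List.append_assoc, E.twist_append _ _ _ b2, List.singleton_append, twist, c1, b7.2]
    have c4 : base (u ++ [(N.prod (E.twist Q.one v), Q.prod (base v))] ++ w) =
        base u ++ Q.prod (base v) :: base w := by simp
    have c5 : base (u ++ v ++ w) = base u ++ (base v ++ base w) := by simp
    have c6 : E.twist Q.one (u ++ v ++ w) = E.twist Q.one u ++
        (E.twist (Q.prod (Q.one :: base u)) v ++
          E.twist (Q.prod (Q.prod (Q.one :: base u) :: base v)) w) := by
      rw [List.append_assoc, E.twist_append _ _ _ b2, E.twist_append _ _ _ b4]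
    refine ⟨⟨?_, ?_⟩, ?_⟩
    · rw [c4]; exact b5.1
    · rw [c3]; exact c2.1
    · refine Prod.ext ?_ ?_
      · change N.prod _ = N.prod _
        rw [c3, c6, c2.2]
      · change Q.prod _ = Q.prod _
        rw [c4, c5, b5.2]
  inv_inv := E.pairInv_pairInv
  inv_append u h := by
    obtain ⟨h1, h2⟩ := h
    have eb : base ((u.map E.pairInv).reverse) = Q.invWord (base u) := by
      simp [base, invWord, pairInv, Function.comp_def]
    have i1 := Q.inv_append _ h1
    have i1' : Q.invWord (base u) ++ base u ∈ Q.D := i1.1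
    have i2 := Q.merge_head (Q.invWord (base u)) (base u) i1'
    have i3 := (Q.insert_one [] _ (Q.invWord_mem h1))
    have i3' : Q.prod (Q.one :: Q.invWord (base u)) = Q.prod (Q.invWord (base u)) := i3.2
    have i4 : E.twist Q.one ((u.map E.pairInv).reverse ++ u) =
        N.invWord (E.twist (Q.prod (Q.invWord (base u))) u) ++
          E.twist (Q.prod (Q.invWord (base u))) u := by
      rw [E.twist_append _ _ _ (by rw [eb]; exact i3.1), eb, i3', E.twist_inverse u h1]
    have i5 := N.inv_append _ ((E.twist_mem_iff _ u i2.1).2 h2)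
    have i6 : base ((u.map E.pairInv).reverse ++ u) = Q.invWord (base u) ++ base u := by
      rw [base, List.map_append]
      exact congrArg (· ++ base u) eb
    refine ⟨⟨?_, ?_⟩, ?_⟩
    · rw [i6]; exact i1'
    · rw [i4]; exact i5.1
    · refine Prod.ext ?_ ?_
      · change N.prod _ = N.prod _
        rw [i4]; exact i5.2
      · change Q.prod _ = Q.prod _
        rw [i6]; exact i1.2

/-- The inclusion `ι : N → L` of the fibre. -/
def incl (_E : TwistingPair N Q) (x : F) : F × B := (x, Q.one)

/-- The projection `τ : L → Q`. -/
def proj (_E : TwistingPair N Q) (a : F × B) : B := a.2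

/-- The extension determined by the twisting pair is isotypical with respect to the `p`-subgroup
`S` of `N` and the collection `Δ` of subgroups of `S`: every outer class `ε(g)`, the class of `Ψ_g`
in `Out(N)`, is the class of an automorphism in `Aut(N; S)`, and `Δ` is `Aut(N; S)`-invariant. -/
structure IsIsotypical (Δ : Set (Set F)) (S : Set F) : Prop where
  outer : ∀ g, ∃ Φ : N.Aut, Φ '' S = S ∧ N.SameOuterClass (E.act g) Φ
  invariant : ∀ Φ : N.Aut, Φ '' S = S → ∀ P ∈ Δ, Φ '' P ∈ Δ

/-- `S` is a `p`-subgroup of `L` which is an extension of `T ≤ Q` by `R ≤ N`: the maps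
`ι` and `τ` restrict to an extension `R → S → T`. -/
structure IsSubextension (p : ℕ) (R : Set F) (T : Set B) (S : Set (F × B)) : Prop where
  isPSubgroup : E.total.IsPSubgroup p S
  incl_mem_iff : ∀ x, E.incl x ∈ S ↔ x ∈ R
  proj_image : E.proj '' S = T

/-- The collection of subgroups `P ≤ S` with `P ∩ R ∈ Δ₁` and `τ(P) ∈ Δ₂`. -/
def objects (R : Set F) (Δ₁ : Set (Set F)) (Δ₂ : Set (Set B)) (S : Set (F × B)) :
    Set (Set (F × B)) :=
  {P | E.total.IsSubgroup P ∧ P ⊆ S ∧ {x ∈ R | E.incl x ∈ P} ∈ Δ₁ ∧ E.proj '' P ∈ Δ₂}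

end TwistingPair

/-! ### Conjugation in partial groups -/

namespace PartialGroup

variable {M : Type*} {G : PartialGroup M}

/-! The substance lies in three points: chain words are multipliable in `L`, (O2) holds, and `S` is
maximal.

Multipliability. A chain of objects for a word `w` projects to a chain in `L''`, so the base word is
multipliable. In the fibre, isotypicality writes each `Ψ_k` as an automorphism `Φ_k` preserving
`S'`, followed by conjugation by some `n_k ∈ N(L')`. The sets `Φ_k(P ∩ S')`, for `P` in the chain,
belong to `Δ'`. A letter `b` of the twisted word, leading from base `k` to `kg`, conjugates one of
them to the next after correction to `n_k⁻¹ b n_{kg}`. The corrected word is therefore in `D_{Δ'} =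
D(L')`, and such a correction by normalizer elements (`Gauge`) does not affect multipliability. This
is `IsIsotypical.exists_gauge`.

Condition (O2). It is replaced by overgroup closure, which is easier to transport. Normalizers grow
in `p`-groups, so (O2) gives this closure for `Δ'` and `Δ''` (`IsLocality.overgroupClosed`). The
closure passes to `Δ` by separate arguments in fibre and base (`IsIsotypical.overgroupClosed`), and
it returns (O2) as soon as conjugates `uXu⁻¹ ⊆ S` of objects are known to be subgroups, for which
`OvergroupClosed.conj_mul` is needed.

Chain words form a partial group because the product of a chain word conjugates between the same two
ends as the word itself (`Chain.prod`). Finally, a `p`-subgroup containing `S` must meet the fibre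
in `S'` and project onto `S''`, by maximality of these two, and so equals `S`. -/

theorem conj_inv_conj {u x : M} (h : [u, x, G.inv u] ∈ G.D) :
    [G.inv u, G.conj u x, G.inv (G.inv u)] ∈ G.D ∧ G.conj (G.inv u) (G.conj u x) = x := by
  have h1 := G.cancel_right [u, x] [G.inv u] h
  have e : G.invWord [G.inv u] = [u] := by simp [invWord, G.inv_inv]
  rw [e] at h1
  have h1' : [u, x, G.inv u, u] ∈ G.D := h1.1
  have h2 := G.cancel_left [u] [x, G.inv u, u] h1'
  have h3 := G.merge [G.inv u] [u, x, G.inv u] [u] h2.1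
  have h4 := G.cancel_right [x] [G.inv u] (G.cons_left h)
  rw [e] at h4
  simp only [conj, G.inv_inv]
  exact ⟨h3.1, h3.2.trans (h2.2.trans (h4.2.trans (G.prod_singleton x)))⟩

theorem conj_inv_arg {u x : M} (h : [u, x, G.inv u] ∈ G.D) :
    [u, G.inv x, G.inv u] ∈ G.D ∧ G.conj u (G.inv x) = G.inv (G.conj u x) := by
  have e : G.invWord [u, x, G.inv u] = [u, G.inv x, G.inv u] := by simp [invWord, G.inv_inv]
  rw [← e, conj, ← e]
  exact ⟨G.invWord_mem h, G.prod_invWord h⟩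

theorem conj_one_right (G : PartialGroup M) (u : M) :
    [u, G.one, G.inv u] ∈ G.D ∧ G.conj u G.one = G.one := by
  have h := G.insert_one [u] [G.inv u] (G.mul_inv_pair u).1
  exact ⟨h.1, h.2.trans (G.mul_inv_pair u).2⟩

theorem conj_mul_right {n x y : M} (hn : n ∈ G.normalizer)
    (h : [x, G.conj n y, G.inv x] ∈ G.D) :
    [G.mul x n, y, G.inv (G.mul x n)] ∈ G.D ∧
      G.conj (G.mul x n) y = G.conj x (G.conj n y) := by
  have hm := inv_mem_normalizer hn
  have h1 := insert_pair hm [x] [G.conj n y, G.inv x] h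
  have h2 := insert_pair hm [x, n, G.inv n, G.conj n y] [G.inv x]
    (by simpa [G.inv_inv] using h1.1)
  rw [G.inv_inv] at h1 h2
  have h3 := G.merge [x, n] [G.inv n, G.conj n y, n] [G.inv n, G.inv x] h2.1
  have e1 : G.prod [G.inv n, G.conj n y, n] = y := by
    have := (conj_inv_conj (hn.1 y)).2
    rwa [conj, G.inv_inv] at this
  rw [e1] at h3
  have h4 := G.merge_head [x, n] [y, G.inv n, G.inv x] h3.1
  have h5 := G.merge [G.prod [x, n], y] [G.inv n, G.inv x] []
    (by simpa using h4.1)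
  have e2 : G.prod [G.inv n, G.inv x] = G.inv (G.mul x n) :=
    (G.inv_mul_rev (mem_xn hn x)).symm
  rw [e2] at h5
  refine ⟨h5.1, h5.2.trans (h4.2.trans (h3.2.trans (h2.2.trans h1.2)))⟩

theorem conj_mul_left {n x y : M} (hn : n ∈ G.normalizer)
    (h : [x, y, G.inv x] ∈ G.D) :
    [G.mul n x, y, G.inv (G.mul n x)] ∈ G.D ∧
      G.conj (G.mul n x) y = G.conj n (G.conj x y) := by
  have hm := inv_mem_normalizer hn
  have h1 : [n, x, y, G.inv x, G.inv n] ∈ G.D := append_mem hm (cons_mem hn h)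
  have h2 := G.merge [n] [x, y, G.inv x] [G.inv n] h1
  have h3 := G.merge_head [n, x] [y, G.inv x, G.inv n] h1
  have h4 := G.merge [G.prod [n, x], y] [G.inv x, G.inv n] [] (by simpa using h3.1)
  have e : G.prod [G.inv x, G.inv n] = G.inv (G.mul n x) :=
    (G.inv_mul_rev (mem_nx hn x)).symm
  rw [e] at h4
  exact ⟨h4.1, h4.2.trans (h3.2.trans h2.2.symm)⟩

theorem image_conj_inv {u : M} {K H : Set M} (hc : G.Conjugable u K) (h : G.conj u '' K = H) :
    G.Conjugable (G.inv u) H ∧ G.conj (G.inv u) '' H = K := by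
  subst h
  refine ⟨?_, ?_⟩
  · rintro _ ⟨x, hx, rfl⟩
    exact (conj_inv_conj (hc x hx)).1
  · rw [Set.image_image]
    have : ∀ x ∈ K, G.conj (G.inv u) (G.conj u x) = id x :=
      fun x hx => (conj_inv_conj (hc x hx)).2
    rw [Set.image_congr this, Set.image_id]

/-! ### Subgroups of partial groups -/

namespace IsSubgroup

variable {H A : Set M}

theorem one_mem (h : G.IsSubgroup H) : G.one ∈ H := h.prod_mem [] (by simp)

theorem mul_mem (h : G.IsSubgroup H) {x y : M} (hx : x ∈ H) (hy : y ∈ H) : G.mul x y ∈ H :=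
  h.prod_mem [x, y] (by simp [hx, hy])

theorem conjugable (h : G.IsSubgroup H) {x : M} (hx : x ∈ H) : G.Conjugable x H := fun y hy =>
  h.word_mem _ (by simp [hx, hy, h.inv_mem x hx])

theorem conj_mem (h : G.IsSubgroup H) {x y : M} (hx : x ∈ H) (hy : y ∈ H) : G.conj x y ∈ H :=
  h.prod_mem _ (by simp [hx, hy, h.inv_mem x hx])

theorem conj_image (h : G.IsSubgroup H) {x : M} (hx : x ∈ H) : G.conj x '' H = H := by
  refine Set.Subset.antisymm ?_ fun y hy => ?_
  · rintro _ ⟨y, hy, rfl⟩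
    exact h.conj_mem hx hy
  · have hi := h.inv_mem x hx
    refine ⟨G.conj (G.inv x) y, h.conj_mem hi hy, ?_⟩
    have := (conj_inv_conj (h.conjugable hi y hy)).2
    rwa [G.inv_inv] at this

/-- A subgroup of a partial group is a group. -/
abbrev group (h : G.IsSubgroup H) : Group H :=
  letI : Mul H := ⟨fun x y => ⟨G.mul x y, h.mul_mem x.2 y.2⟩⟩
  letI : One H := ⟨⟨G.one, h.one_mem⟩⟩
  letI : Inv H := ⟨fun x => ⟨G.inv x, h.inv_mem x x.2⟩⟩
  Group.ofLeftAxioms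
    (fun x y z => Subtype.ext (G.mul_assoc (h.word_mem [x.1, y.1, z.1] (by simp))))
    (fun x => Subtype.ext (G.one_mul x)) (fun x => Subtype.ext (G.inv_mul_pair x.1).2)

theorem of_subset (h : G.IsSubgroup H) (hA : A ⊆ H) (h1 : G.one ∈ A)
    (hm : ∀ x ∈ A, ∀ y ∈ A, G.mul x y ∈ A) (hi : ∀ x ∈ A, G.inv x ∈ A) : G.IsSubgroup A where
  nonempty := ⟨_, h1⟩
  inv_mem := hi
  word_mem w hw := h.word_mem w fun x hx => hA (hw x hx)
  prod_mem w hw := by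
    induction w with
    | nil => exact h1
    | cons a w ih =>
      rw [(G.prod_cons a w (h.word_mem _ fun x hx => hA (hw x hx))).2]
      exact hm _ (hw a (by simp)) _ (ih fun x hx => hw x (by simp [hx]))

theorem conj_coe (h : G.IsSubgroup H) (x y : H) :
    letI := h.group
    ((x * y * x⁻¹ : H) : M) = G.conj x y := by
  have hw : [x.1, y.1, G.inv x.1] ∈ G.D := h.conjugable x.2 y.1 y.2
  have := (G.merge_head [x.1, y.1] [G.inv x.1] hw).2
  exact this

/-- `normalizerIn` asks only for `yAy⁻¹ ⊆ A`. Finiteness turns this into equality, as the normalizer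
of group theory requires. -/
theorem normalizerIn_eq [Finite M] (h : G.IsSubgroup H) (hA : A ⊆ H) :
    letI := h.group
    G.normalizerIn H A = Subtype.val '' (Subgroup.normalizer (Subtype.val ⁻¹' A : Set H) : Set H) := by
  let := h.group
  ext y
  constructor
  · rintro ⟨hy, -, h2⟩
    refine ⟨⟨y, hy⟩, Subgroup.mem_normalizer_fintype fun n hn => ?_, rfl⟩
    change ((⟨y, hy⟩ * n * ⟨y, hy⟩⁻¹ : H) : M) ∈ A
    rw [h.conj_coe]
    exact h2 ⟨n, hn, rfl⟩
  · rintro ⟨y, hy, rfl⟩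
    refine ⟨y.2, fun x hx => h.conjugable y.2 x (hA hx), ?_⟩
    rintro _ ⟨x, hx, rfl⟩
    have : ((y * ⟨x, hA hx⟩ * y⁻¹ : H) : M) ∈ A :=
      (Subgroup.mem_set_normalizer_iff.1 hy ⟨x, hA hx⟩).1 hx
    rwa [h.conj_coe] at this

theorem coe_subgroup (h : G.IsSubgroup H) :
    letI := h.group
    ∀ K : Subgroup H, G.IsSubgroup (Subtype.val '' (K : Set H)) := by
  let := h.group
  intro K
  refine h.of_subset (by simp) ?_ ?_ ?_
  · exact ⟨1, K.one_mem, rfl⟩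
  · rintro _ ⟨x, hx, rfl⟩ _ ⟨y, hy, rfl⟩
    exact ⟨x * y, K.mul_mem hx hy, rfl⟩
  · rintro _ ⟨x, hx, rfl⟩
    exact ⟨x⁻¹, K.inv_mem hx, rfl⟩

theorem normalizerIn [Finite M] (h : G.IsSubgroup H) (hA : A ⊆ H) :
    G.IsSubgroup (G.normalizerIn H A) := by
  rw [h.normalizerIn_eq hA]
  exact h.coe_subgroup _

theorem subset_normalizerIn (hA : G.IsSubgroup A) (hAH : A ⊆ H) :
    A ⊆ G.normalizerIn H A := fun _ hx =>
  ⟨hAH hx, hA.conjugable hx, (hA.conj_image hx).subset⟩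

/-- A subgroup contained in another one, as a subgroup of a group. -/
abbrev toSubgroup (h : G.IsSubgroup H) (hA : G.IsSubgroup A) :
    letI := h.group
    Subgroup H :=
  letI := h.group
  { carrier := Subtype.val ⁻¹' A
    mul_mem' := hA.mul_mem
    one_mem' := hA.one_mem
    inv_mem' := hA.inv_mem _ }

theorem ncard_dvd (h : G.IsSubgroup H) (hA : G.IsSubgroup A) (hAH : A ⊆ H) :
    A.ncard ∣ H.ncard := by
  let := h.group
  have := (h.toSubgroup hA).card_subgroup_dvd_card
  have e : Subtype.val '' ((h.toSubgroup hA : Subgroup H) : Set H) = A := by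
    simp [toSubgroup, hAH]
  rw [← e, Set.ncard_image_of_injective _ Subtype.val_injective, ← Nat.card_coe_set_eq,
    ← Nat.card_coe_set_eq]
  exact this

variable {M' : Type*} {G' : PartialGroup M'} {H' : Set M'}

/-- A multiplicative map between subgroups. -/
abbrev monoidHom (h : G.IsSubgroup H) (h' : G'.IsSubgroup H') (f : M → M')
    (hf : ∀ x ∈ H, f x ∈ H') (hm : ∀ x ∈ H, ∀ y ∈ H, f (G.mul x y) = G'.mul (f x) (f y)) :
    letI := h.group
    letI := h'.group
    H →* H' :=
  letI := h.group
  letI := h'.group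
  MonoidHom.mk' (fun x => ⟨f x, hf x x.2⟩) fun x y => Subtype.ext (hm x x.2 y y.2)

theorem ncard_dvd_of_surjOn (h : G.IsSubgroup H) (h' : G'.IsSubgroup H') (f : M → M')
    (hf : f '' H = H') (hm : ∀ x ∈ H, ∀ y ∈ H, f (G.mul x y) = G'.mul (f x) (f y)) :
    H'.ncard ∣ H.ncard := by
  let := h.group
  let := h'.group
  have := Subgroup.card_dvd_of_surjective
    (h.monoidHom h' f (fun x hx => hf ▸ ⟨x, hx, rfl⟩) hm) (by
      rintro ⟨y, hy⟩
      rw [← hf] at hy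
      obtain ⟨x, hx, rfl⟩ := hy
      exact ⟨⟨x, hx⟩, rfl⟩)
  rwa [Nat.card_coe_set_eq, Nat.card_coe_set_eq] at this

theorem ncard_dvd_of_injOn (h : G.IsSubgroup H) (h' : G'.IsSubgroup H') (f : M → M')
    (hf : ∀ x ∈ H, f x ∈ H') (hm : ∀ x ∈ H, ∀ y ∈ H, f (G.mul x y) = G'.mul (f x) (f y))
    (hi : Set.InjOn f H) : H.ncard ∣ H'.ncard := by
  let := h.group
  let := h'.group
  have := Subgroup.card_dvd_of_injective (h.monoidHom h' f hf hm)
    fun x y hxy => Subtype.ext (hi x.2 y.2 (congrArg Subtype.val hxy))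
  rwa [Nat.card_coe_set_eq, Nat.card_coe_set_eq] at this

end IsSubgroup

theorem IsPSubgroup.of_ncard_dvd {M' : Type*} {G' : PartialGroup M'} {p : ℕ} (hp : p.Prime)
    {H : Set M} {H' : Set M'} (h : G.IsPSubgroup p H) (h' : G'.IsSubgroup H')
    (hd : H'.ncard ∣ H.ncard) : G'.IsPSubgroup p H' := by
  obtain ⟨k, hk⟩ := h.card_eq
  rw [hk] at hd
  obtain ⟨j, -, hj⟩ := (Nat.dvd_prime_pow hp).1 hd
  exact ⟨h', j, hj⟩

/-- Normalizers grow in `p`-groups. -/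
theorem IsPSubgroup.eq_of_normalizerIn_subset [Finite M] {p : ℕ} (hp : p.Prime) {Y A : Set M}
    (hY : G.IsPSubgroup p Y) (hA : G.IsSubgroup A) (hAY : A ⊆ Y)
    (h : G.normalizerIn Y A ⊆ A) : A = Y := by
  have hs := hY.toIsSubgroup
  let := hs.group
  have : Fact p.Prime := ⟨hp⟩
  have hpg : IsPGroup p Y := by
    obtain ⟨k, hk⟩ := hY.card_eq
    exact IsPGroup.of_card (by rwa [Nat.card_coe_set_eq])
  have hn := hpg.isNilpotent
  by_contra hne
  have hlt : hs.toSubgroup hA < ⊤ := by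
    refine lt_top_iff_ne_top.2 fun htop => hne (hAY.antisymm fun y hy => ?_)
    have : (⟨y, hy⟩ : Y) ∈ hs.toSubgroup hA := htop ▸ Subgroup.mem_top _
    exact this
  obtain ⟨y, hy, hyA⟩ := Set.exists_of_ssubset
    (Group.normalizerCondition_of_isNilpotent _ hlt)
  refine hyA (h ?_)
  rw [hs.normalizerIn_eq hAY]
  exact ⟨y, hy, rfl⟩

end PartialGroup

/-! ### Chains of objects -/

namespace PartialGroup

variable {M : Type*} {G : PartialGroup M} {Δ : Set (Set M)}

/-- `w = (u₁, …, uₙ)` conjugates a chain `H = H₀, …, Hₙ = K` of members of `Δ`, in the sense that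
`uᵢ Hᵢ uᵢ⁻¹ = Hᵢ₋₁`. -/
inductive Chain (G : PartialGroup M) (Δ : Set (Set M)) : List M → Set M → Set M → Prop
  | nil {H : Set M} : H ∈ Δ → Chain G Δ [] H H
  | cons {u : M} {w : List M} {H K R : Set M} : H ∈ Δ → G.Conjugable u K → G.conj u '' K = H →
      Chain G Δ w K R → Chain G Δ (u :: w) H R

namespace Chain

variable {u : M} {v w : List M} {H K R : Set M}

theorem mem_left (h : G.Chain Δ w H K) : H ∈ Δ := by cases h <;> assumption

theorem mem_right (h : G.Chain Δ w H K) : K ∈ Δ := by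
  induction h with
  | nil h => exact h
  | cons _ _ _ _ ih => exact ih

theorem conjugatesChain (h : G.Chain Δ w H K) : G.ConjugatesChain Δ w H := by
  induction h with
  | nil h => exact h
  | cons h1 h2 h3 _ ih => exact ⟨h1, _, h2, h3, ih⟩

theorem of_conjugatesChain : ∀ {w : List M} {H : Set M}, G.ConjugatesChain Δ w H →
    ∃ K, G.Chain Δ w H K
  | [], _, h => ⟨_, .nil h⟩
  | _ :: _, _, h => by
    obtain ⟨h1, K, h2, h3, h4⟩ := h
    obtain ⟨R, hR⟩ := of_conjugatesChain h4
    exact ⟨R, .cons h1 h2 h3 hR⟩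

theorem mem_chainWords (h : G.Chain Δ w H K) : w ∈ G.chainWords Δ := ⟨H, h.conjugatesChain⟩

theorem of_mem_chainWords (h : w ∈ G.chainWords Δ) : ∃ H K, G.Chain Δ w H K := by
  obtain ⟨H, h⟩ := h
  exact ⟨H, of_conjugatesChain h⟩

theorem append (h : G.Chain Δ v H K) (h' : G.Chain Δ w K R) : G.Chain Δ (v ++ w) H R := by
  induction h with
  | nil _ => exact h'
  | cons h1 h2 h3 _ ih => exact .cons h1 h2 h3 (ih h')

theorem exists_of_append : ∀ {v w : List M} {H R : Set M}, G.Chain Δ (v ++ w) H R →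
    ∃ K, G.Chain Δ v H K ∧ G.Chain Δ w K R
  | [], _, _, _, h => ⟨_, .nil h.mem_left, h⟩
  | _ :: _, _, _, _, h => by
    cases h with
    | cons h1 h2 h3 h4 =>
      obtain ⟨K, h5, h6⟩ := exists_of_append h4
      exact ⟨K, .cons h1 h2 h3 h5, h6⟩

theorem single (hH : H ∈ Δ) (hK : K ∈ Δ) (hc : G.Conjugable u K) (h : G.conj u '' K = H) :
    G.Chain Δ [u] H K := .cons hH hc h (.nil hK)

theorem invWord (h : G.Chain Δ w H K) : G.Chain Δ (G.invWord w) K H := by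
  induction h with
  | nil h => exact .nil h
  | @cons u w H K R h1 h2 h3 h4 ih =>
    have := image_conj_inv h2 h3
    have e : G.invWord (u :: w) = G.invWord w ++ [G.inv u] := by simp [PartialGroup.invWord]
    rw [e]
    exact ih.append (single h4.mem_left h1 this.1 this.2)

theorem inv_single (h : G.Chain Δ [u] H K) : G.Chain Δ [G.inv u] K H := h.invWord

/-- The constant chain at `H` serves. -/
theorem of_mem_subgroup (hΔ : H ∈ Δ) (hH : G.IsSubgroup H) (w : List M) (hw : ∀ x ∈ w, x ∈ H) :
    G.Chain Δ w H H := by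
  induction w with
  | nil => exact .nil hΔ
  | cons u w ih =>
    have hu := hw u (by simp)
    exact .cons hΔ (hH.conjugable hu) (hH.conj_image hu) (ih fun x hx => hw x (by simp [hx]))

variable (hD : G.chainWords Δ ⊆ G.D) (hs : ∀ P ∈ Δ, G.IsSubgroup P)
include hD

theorem mem_D (h : G.Chain Δ w H K) : w ∈ G.D := hD h.mem_chainWords

include hs

/-- The word is a loop at `H`: `w` joins `H` to `K`, the letter `x ∈ K` fixes `K`, and the inverse
word leads back. -/
theorem conj_word_mem (h : G.Chain Δ w H K) {x : M} (hx : x ∈ K) :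
    w ++ x :: G.invWord w ∈ G.D :=
  (h.append ((of_mem_subgroup h.mem_right (hs _ h.mem_right) [x] (by simpa)).append
    h.invWord)).mem_D hD

theorem conj_word_prod_mem (h : G.Chain Δ w H K) {x : M} (hx : x ∈ K) :
    G.prod (w ++ x :: G.invWord w) ∈ H := by
  induction h with
  | nil h => simpa [PartialGroup.invWord, G.prod_singleton] using hx
  | @cons u w H K R h1 h2 h3 h4 ih =>
    have h5 := (Chain.cons h1 h2 h3 h4).conj_word_mem hD hs hx
    have e : u :: w ++ x :: G.invWord (u :: w) =
      [u] ++ ((w ++ x :: G.invWord w) ++ [G.inv u]) := by simp [PartialGroup.invWord]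
    rw [e] at h5 ⊢
    rw [← (G.merge _ _ _ h5).2, ← h3]
    exact ⟨_, ih hx, rfl⟩

theorem conj_prod (h : G.Chain Δ w H K) {x : M} (hx : x ∈ K) :
    [G.prod w, x, G.inv (G.prod w)] ∈ G.D ∧ G.conj (G.prod w) x ∈ H := by
  have h1 := h.conj_word_mem hD hs hx
  have h2 := G.merge_head _ _ h1
  have h3 := G.merge [G.prod w, x] (G.invWord w) [] (by simpa using h2.1)
  rw [G.prod_invWord (h.mem_D hD)] at h3
  refine ⟨h3.1, ?_⟩
  have h4 : G.conj (G.prod w) x = G.prod (w ++ x :: G.invWord w) := by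
    refine h3.2.trans (Eq.trans ?_ h2.2)
    simp
  rw [h4]
  exact h.conj_word_prod_mem hD hs hx

/-- Conjugation by the product is conjugation by the letters one after another, which gives one
inclusion. The other is the same statement for the inverse word. -/
theorem prod (h : G.Chain Δ w H K) : G.Chain Δ [G.prod w] H K := by
  refine single h.mem_left h.mem_right (fun x hx => (h.conj_prod hD hs hx).1)
    (Set.Subset.antisymm ?_ fun y hy => ?_)
  · rintro _ ⟨x, hx, rfl⟩
    exact (h.conj_prod hD hs hx).2
  · have h1 := h.invWord.conj_prod hD hs hy
    rw [G.prod_invWord (h.mem_D hD)] at h1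
    refine ⟨_, h1.2, ?_⟩
    have := (conj_inv_conj h1.1).2
    rwa [G.inv_inv] at this

end Chain

/-- The collection `Δ` of subgroups of `S` is closed under passing from `X` to the subgroups of `S`
which contain a conjugate of `X`. -/
def OvergroupClosed (G : PartialGroup M) (Δ : Set (Set M)) (S : Set M) : Prop :=
  ∀ X ∈ Δ, ∀ u, G.Conjugable u X → ∀ Y, G.IsSubgroup Y → Y ⊆ S → G.conj u '' X ⊆ Y → Y ∈ Δ

/-- (O2) only puts `N_Y(uXu⁻¹)` into `Δ`. From there one passes repeatedly to the normalizer in `Y`;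
as `Y` is a finite `p`-group, this grows until it reaches `Y`. The induction is on `|Y| - |A|`. -/
theorem IsLocality.overgroupClosed {p : ℕ} (hp : p.Prime) {S : Set M}
    (h : G.IsLocality p Δ S) : G.OvergroupClosed Δ S := by
  have := h.finite
  intro X hX u hu Y hY hYS hXY
  have hYp : G.IsPSubgroup p Y := h.isPSubgroup.of_ncard_dvd hp hY
    (h.isPSubgroup.toIsSubgroup.ncard_dvd hY hYS)
  have key : ∀ n : ℕ, ∀ A ∈ Δ, A ⊆ Y → Y.ncard - A.ncard = n → Y ∈ Δ := by
    intro n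
    induction n using Nat.strong_induction_on with
    | _ n ih =>
      intro A hA hAY hn
      have hAs := h.isObjective.isSubgroup A hA
      by_cases hN : G.normalizerIn Y A ⊆ A
      · rwa [← hYp.eq_of_normalizerIn_subset hp hAs hAY hN]
      -- (O2) with the unit as conjugating element puts `N_Y(A)` into `Δ`.
      · have e : G.conj G.one '' A = A := hAs.conj_image hAs.one_mem
        have hNΔ := h.isObjective.normalizerIn_mem A hA S h.mem Y hY hYS G.one
          (hAs.conjugable hAs.one_mem) (e.symm ▸ hAY)
        rw [e] at hNΔ
        have hsub : G.normalizerIn Y A ⊆ Y := fun y hy => hy.1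
        have hlt := Set.ncard_lt_ncard (s := A) ⟨hAs.subset_normalizerIn hAY, hN⟩
        have hle := Set.ncard_le_ncard hsub
        exact ih _ (by omega) _ hNΔ hsub rfl
  exact key _ _ (h.isObjective.normalizerIn_mem X hX S h.mem Y hY hYS u hu hXY)
    (fun y hy => hy.1) rfl

/-! ### Overgroup closed collections are objective -/

section Overgroup

variable {S : Set M} (hD : G.chainWords Δ ⊆ G.D) (hs : ∀ P ∈ Δ, G.IsSubgroup P)
  (hS : G.IsSubgroup S) (hsub : ∀ P ∈ Δ, P ⊆ S) (ho : G.OvergroupClosed Δ S)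
include hS hsub ho

/-- Conjugation by `s` is an automorphism of the group `S`, so `sKs⁻¹` is a subgroup of `S`. It is
an object because it contains a conjugate of `K`, namely itself. -/
theorem OvergroupClosed.exists_chain {K : Set M} (hK : K ∈ Δ) {s : M} (hsS : s ∈ S)
    (hs : ∀ P ∈ Δ, G.IsSubgroup P) : ∃ H, G.Chain Δ [s] H K := by
  have hc : G.Conjugable s K := fun x hx => hS.conjugable hsS x (hsub K hK hx)
  have hKs := hs K hK
  have hle : G.conj s '' K ⊆ S := by
    rintro _ ⟨x, hx, rfl⟩
    exact hS.conj_mem hsS (hsub K hK hx)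
  refine ⟨_, .single (ho K hK s hc _ ?_ hle subset_rfl) hK hc rfl⟩
  let := hS.group
  refine hS.of_subset hle ⟨_, hKs.one_mem, (G.conj_one_right s).2⟩ ?_ ?_
  · rintro _ ⟨x, hx, rfl⟩ _ ⟨y, hy, rfl⟩
    refine ⟨_, hKs.mul_mem hx hy, ?_⟩
    have e : ∀ z : S, G.conj s z = ((⟨s, hsS⟩ * z * ⟨s, hsS⟩⁻¹ : S) : M) :=
      fun z => (hS.conj_coe ⟨s, hsS⟩ z).symm
    have hx' := hsub K hK hx
    have hy' := hsub K hK hy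
    have e3 := e (⟨x, hx'⟩ * ⟨y, hy'⟩)
    have e1 := e ⟨x, hx'⟩
    have e2 := e ⟨y, hy'⟩
    change G.conj s (G.mul x y) = _ at e3
    dsimp only at e1 e2
    rw [e1, e2, e3, ← _root_.conj_mul]
    rfl
  · rintro _ ⟨x, hx, rfl⟩
    exact ⟨_, hKs.inv_mem x hx, (conj_inv_arg (hc x hx)).2⟩

include hD hs

/-- If `u` and `a ∈ S` are such that `u a u⁻¹ ∈ S`, then the objects which `u` conjugates to objects
are permuted by conjugation with `a`. -/
theorem OvergroupClosed.chain_conj {u a : M} {H K : Set M} (hu : G.Chain Δ [u] H K) (ha : a ∈ S)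
    (hua : [u, a, G.inv u] ∈ G.D) (hb : G.conj u a ∈ S) :
    ∃ H' K', G.Chain Δ [a] K' K ∧ G.Chain Δ [u] H' K' := by
  obtain ⟨K', hK'⟩ := ho.exists_chain hS hsub hu.mem_right ha hs
  obtain ⟨H', hH'⟩ := ho.exists_chain hS hsub hu.mem_left hb hs
  -- With `b = uau⁻¹`, the word `(b, u, a⁻¹)` runs from `K'` through `K` and `H` to `H'`. Its
  -- product is `u`, since `bu = ua`, so `u` itself conjugates `K'` to `H'`.
  have hw : G.Chain Δ [G.conj u a, u, G.inv a] H' K' := hH'.append (hu.append hK'.inv_single)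
  refine ⟨H', K', hK', ?_⟩
  have h1 := G.cancel_right [u, a] [G.inv u] hua
  have e : G.invWord [G.inv u] = [u] := by simp [invWord, G.inv_inv]
  rw [e] at h1
  have h2 := G.merge_head [u, a, G.inv u] [u] h1.1
  have h3 : G.prod [G.conj u a, u] = G.prod [u, a] := h2.2.trans h1.2
  have h4 := G.merge_head [G.conj u a, u] [G.inv a] (hw.mem_D hD)
  have h5 := G.cancel_right [u] [a] (G.left_mem (v := [G.inv u]) hua)
  have h6 := G.merge_head [u, a] [G.inv a] h5.1
  have h7 : G.prod [G.conj u a, u, G.inv a] = u := by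
    refine h4.2.symm.trans ?_
    rw [h3]
    exact h6.2.trans (h5.2.trans (G.prod_singleton u))
  have := hw.prod hD hs
  rwa [h7] at this

/-- That `(u, a, u⁻¹)` and `(u, b, u⁻¹)` are multipliable does not by itself make `(u, a, b, u⁻¹)`
so. Moving the chain of `u` first by `b` and then by `a` yields chains that fit together, both for
`(u, a, b, u⁻¹)` and for `(u, a, u⁻¹, u, b, u⁻¹)`. The products of these two words agree by
cancelling `u⁻¹, u`. -/
theorem OvergroupClosed.conj_mul {u a b : M} {H K : Set M} (hu : G.Chain Δ [u] H K)
    (ha : a ∈ S) (hua : [u, a, G.inv u] ∈ G.D) (ha' : G.conj u a ∈ S)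
    (hb : b ∈ S) (hub : [u, b, G.inv u] ∈ G.D) (hb' : G.conj u b ∈ S) :
    G.conj u (G.mul a b) = G.mul (G.conj u a) (G.conj u b) := by
  obtain ⟨H1, K1, h1, h2⟩ := ho.chain_conj hD hs hS hsub hu hb hub hb'
  obtain ⟨H2, K2, h3, h4⟩ := ho.chain_conj hD hs hS hsub h2 ha hua ha'
  have hw : G.Chain Δ [u, a, G.inv u, u, b, G.inv u] H2 H :=
    h4.append (h3.append (h2.inv_single.append (h2.append (h1.append hu.inv_single))))
  have hw' : G.Chain Δ [u, a, b, G.inv u] H2 H :=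
    h4.append (h3.append (h1.append hu.inv_single))
  have c1 := G.merge [u] [a, b] [G.inv u] (hw'.mem_D hD)
  have c2 := G.insert_one [u, a] [b, G.inv u] (hw'.mem_D hD)
  have c3 := G.merge [u, a] [G.inv u, u] [b, G.inv u] (hw.mem_D hD)
  have c4 : G.prod [G.inv u, u] = G.one := (G.inv_mul_pair u).2
  rw [c4] at c3
  have c5 := G.merge_head [u, a, G.inv u] [u, b, G.inv u] (hw.mem_D hD)
  have c6 := G.merge [G.prod [u, a, G.inv u]] [u, b, G.inv u] [] (by simpa using c5.1)
  exact c1.2.trans (c2.2.symm.trans (c3.2.trans (c5.2.symm.trans c6.2.symm)))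

/-- Overgroup closed collections are objective. -/
theorem OvergroupClosed.isObjective [Finite M] (hD' : G.D = G.chainWords Δ) :
    G.IsObjective Δ where
  isSubgroup := hs
  domain_eq := hD'
  normalizerIn_mem X hX Z hZ Y hY hYZ u hu hXY := by
    have hYS : Y ⊆ S := hYZ.trans (hsub Z hZ)
    have hXs := hs X hX
    have hXS := hsub X hX
    have hm : ∀ x ∈ X, G.conj u x ∈ S := fun x hx => hYS (hXY ⟨x, hx, rfl⟩)
    -- This chain for `u` need not involve `X`; it is only the starting point for `conj_mul`.
    obtain ⟨H, K, hc⟩ := Chain.of_mem_chainWords (hD' ▸ G.singleton_mem u)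
    have hA : G.IsSubgroup (G.conj u '' X) := by
      refine hY.of_subset hXY ⟨_, hXs.one_mem, (G.conj_one_right u).2⟩ ?_ ?_
      · rintro _ ⟨x, hx, rfl⟩ _ ⟨y, hy, rfl⟩
        exact ⟨_, hXs.mul_mem hx hy, ho.conj_mul hD hs hS hsub hc (hXS hx) (hu x hx) (hm x hx)
          (hXS hy) (hu y hy) (hm y hy)⟩
      · rintro _ ⟨x, hx, rfl⟩
        exact ⟨_, hXs.inv_mem x hx, (conj_inv_arg (hu x hx)).2⟩
    exact ho X hX u hu _ (hY.normalizerIn hXY) (fun y hy => hYS hy.1)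
      (hA.subset_normalizerIn hXY)

end Overgroup

end PartialGroup

/-! ### The partial group of chain words -/

namespace PartialGroup

variable {M : Type*} {G : PartialGroup M} {Δ : Set (Set M)}

theorem singleton_mem_chainWords {w : List M} (h : w ∈ G.chainWords Δ) :
    ∀ f ∈ w, [f] ∈ G.chainWords Δ := by
  obtain ⟨H, K, h⟩ := Chain.of_mem_chainWords h
  induction h with
  | nil _ => simp
  | cons h1 h2 h3 h4 ih =>
    intro f hf
    rcases List.mem_cons.1 hf with rfl | hf
    · exact (Chain.single h1 h4.mem_left h2 h3).mem_chainWords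
    · exact ih h4.mem_chainWords f hf

theorem nil_mem_chainWords (hne : Δ.Nonempty) : [] ∈ G.chainWords Δ :=
  (Chain.nil hne.some_mem).mem_chainWords

/-- Every element of an object is a one-letter chain word, so no object loses elements on passing to
the restriction. -/
theorem image_preimage_val (hs : ∀ P ∈ Δ, G.IsSubgroup P) {P : Set M} (hP : P ∈ Δ) :
    Subtype.val '' (Subtype.val ⁻¹' P : Set {f : M // [f] ∈ G.chainWords Δ}) = P := by
  refine Set.image_preimage_eq_of_subset fun x hx => ?_
  exact ⟨⟨x, (Chain.of_mem_subgroup hP (hs P hP) [x] (by simpa using hx)).mem_chainWords⟩, rfl⟩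

theorem inv_mem_chainWords {f : M} (h : [f] ∈ G.chainWords Δ) : [G.inv f] ∈ G.chainWords Δ := by
  obtain ⟨H, K, h⟩ := Chain.of_mem_chainWords h
  exact h.inv_single.mem_chainWords

section Restriction

variable (hne : Δ.Nonempty) (hD : G.chainWords Δ ⊆ G.D) (hs : ∀ P ∈ Δ, G.IsSubgroup P)
include hD hs

theorem prod_mem_chainWords {w : List M} (h : w ∈ G.chainWords Δ) :
    [G.prod w] ∈ G.chainWords Δ := by
  obtain ⟨H, K, h⟩ := Chain.of_mem_chainWords h
  exact (h.prod hD hs).mem_chainWords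

include hne

open Classical in
/-- The partial group whose set of multipliable words is `D_Δ`. -/
noncomputable def restriction : PartialGroup {f : M // [f] ∈ G.chainWords Δ} where
  D := {w | w.map Subtype.val ∈ G.chainWords Δ}
  -- Words outside `D_Δ` get the unit as default value. It is available because a nonempty `Δ` makes
  -- the empty word a chain word.
  prod w := if h : w.map Subtype.val ∈ G.chainWords Δ then
      ⟨G.prod (w.map Subtype.val), prod_mem_chainWords hD hs h⟩
    else ⟨G.prod [], prod_mem_chainWords hD hs (nil_mem_chainWords hne)⟩
  inv f := ⟨G.inv f, inv_mem_chainWords f.2⟩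
  singleton_mem x := x.2
  of_append u v h := by
    rw [Set.mem_ofPred_eq, List.map_append] at h
    obtain ⟨H, R, h⟩ := Chain.of_mem_chainWords h
    obtain ⟨K, h1, h2⟩ := h.exists_of_append
    exact ⟨h1.mem_chainWords, h2.mem_chainWords⟩
  prod_singleton x := by
    have h : [x].map Subtype.val ∈ G.chainWords Δ := x.2
    rw [dif_pos h]
    exact Subtype.ext (G.prod_singleton x)
  prod_append u v w h := by
    have h' := h
    rw [Set.mem_ofPred_eq, List.map_append, List.map_append] at h'
    obtain ⟨H, R, h1⟩ := Chain.of_mem_chainWords h'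
    obtain ⟨K, h2, h3⟩ := h1.exists_of_append
    obtain ⟨L, h4, h5⟩ := h2.exists_of_append
    -- The stretch of the chain belonging to `v` is replaced by the single letter `Π(v)`, which has
    -- the same ends.
    have h6 := ((h4.append (h5.prod hD hs)).append h3).mem_chainWords
    rw [dif_pos h5.mem_chainWords]
    have e : ∀ f : {f : M // [f] ∈ G.chainWords Δ}, (u ++ [f] ++ w).map Subtype.val =
        u.map Subtype.val ++ [f.1] ++ w.map Subtype.val := fun f => by simp
    replace e := e ⟨G.prod (v.map Subtype.val), prod_mem_chainWords hD hs h5.mem_chainWords⟩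
    refine ⟨Eq.mpr (congrArg (· ∈ G.chainWords Δ) e) h6, ?_⟩
    rw [dif_pos (Eq.mpr (congrArg (· ∈ G.chainWords Δ) e) h6),
      dif_pos (show (u ++ v ++ w).map Subtype.val ∈ G.chainWords Δ from h)]
    refine Subtype.ext ?_
    change G.prod _ = G.prod _
    rw [e, (G.prod_append _ _ _ (hD h')).2]
    simp
  inv_inv x := Subtype.ext (G.inv_inv x)
  inv_append u h := by
    obtain ⟨H, R, h1⟩ := Chain.of_mem_chainWords h
    have h2 := (h1.invWord.append h1).mem_chainWords
    have e : ((u.map fun f : {f : M // [f] ∈ G.chainWords Δ} =>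
        (⟨G.inv f, inv_mem_chainWords f.2⟩ : {f : M // [f] ∈ G.chainWords Δ})).reverse ++ u).map
        Subtype.val = G.invWord (u.map Subtype.val) ++ u.map Subtype.val := by
      simp [invWord, Function.comp_def]
    have h3 := Eq.mpr (congrArg (· ∈ G.chainWords Δ) e) h2
    refine ⟨h3, ?_⟩
    have h4 : ([] : List {f : M // [f] ∈ G.chainWords Δ}).map Subtype.val ∈ G.chainWords Δ :=
      nil_mem_chainWords hne
    rw [dif_pos h3, dif_pos h4]
    refine Subtype.ext ?_
    change G.prod _ = G.prod _
    rw [e]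
    exact (G.inv_append _ (hD h)).2

theorem isRestriction_restriction :
    G.IsRestriction (G.chainWords Δ) (restriction hne hD hs) where
  subset := hD
  mem_iff _ := Iff.rfl
  letters _ h := singleton_mem_chainWords h
  prod_eq w h := by
    have h' : w.map Subtype.val ∈ G.chainWords Δ := h
    simp only [restriction, dif_pos h']
  inv_eq _ := rfl

end Restriction

/-! ### Comparison of a partial group with its restriction to chain words -/

namespace IsRestriction

variable {T : PartialGroup {f : M // [f] ∈ G.chainWords Δ}}
  (hT : G.IsRestriction (G.chainWords Δ) T)
include hT

theorem conj_word_mem_iff (u x : {f : M // [f] ∈ G.chainWords Δ}) :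
    [u, x, T.inv u] ∈ T.D ↔ [u.1, x.1, G.inv u] ∈ G.chainWords Δ := by
  rw [hT.mem_iff, ← hT.inv_eq]
  rfl

theorem conj_eq {u x : {f : M // [f] ∈ G.chainWords Δ}} (h : [u, x, T.inv u] ∈ T.D) :
    (T.conj u x : M) = G.conj u x := by
  rw [conj, hT.prod_eq _ h, conj, ← hT.inv_eq]
  rfl

/-- Multipliable words of `T` are multipliable in `G`. Through this, maximality of `S` in `G` is
inherited by `T`. -/
theorem isSubgroup_image {Q : Set {f : M // [f] ∈ G.chainWords Δ}} (hQ : T.IsSubgroup Q) :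
    G.IsSubgroup (Subtype.val '' Q) where
  nonempty := hQ.nonempty.image _
  inv_mem := by
    rintro _ ⟨x, hx, rfl⟩
    exact ⟨_, hQ.inv_mem x hx, hT.inv_eq x⟩
  word_mem w hw := by
    lift w to List {f : M // [f] ∈ G.chainWords Δ} using
      fun x hx => by obtain ⟨y, -, rfl⟩ := hw x hx; exact y.2
    refine hT.subset ((hT.mem_iff w).1 (hQ.word_mem w fun x hx => ?_))
    exact Subtype.val_injective.mem_set_image.1 (hw x (List.mem_map_of_mem hx))
  prod_mem w hw := by
    lift w to List {f : M // [f] ∈ G.chainWords Δ} using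
      fun x hx => by obtain ⟨y, -, rfl⟩ := hw x hx; exact y.2
    have hw' : ∀ x ∈ w, x ∈ Q := fun x hx =>
      Subtype.val_injective.mem_set_image.1 (hw x (List.mem_map_of_mem hx))
    exact ⟨_, hQ.prod_mem w hw', hT.prod_eq _ (hQ.word_mem w hw')⟩

theorem isPSubgroup_image {p : ℕ} {Q : Set {f : M // [f] ∈ G.chainWords Δ}}
    (hQ : T.IsPSubgroup p Q) : G.IsPSubgroup p (Subtype.val '' Q) :=
  ⟨hT.isSubgroup_image hQ.toIsSubgroup, by
    rw [Set.ncard_image_of_injective _ Subtype.val_injective]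
    exact hQ.card_eq⟩

theorem chain_map {w : List {f : M // [f] ∈ G.chainWords Δ}}
    {H K : Set {f : M // [f] ∈ G.chainWords Δ}}
    (h : T.Chain {P | Subtype.val '' P ∈ Δ} w H K) :
    G.Chain Δ (w.map Subtype.val) (Subtype.val '' H) (Subtype.val '' K) := by
  induction h with
  | nil h => exact .nil h
  | @cons u w H K R h1 h2 h3 h4 ih =>
    refine .cons h1 ?_ ?_ ih
    · rintro _ ⟨x, hx, rfl⟩
      exact hT.subset ((hT.conj_word_mem_iff u x).1 (h2 x hx))
    · rw [← h3, Set.image_image, Set.image_image]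
      exact Set.image_congr fun x hx => (hT.conj_eq (h2 x hx)).symm

theorem overgroupClosed {S : Set M} (h : G.OvergroupClosed Δ S) :
    T.OvergroupClosed {P | Subtype.val '' P ∈ Δ} (Subtype.val ⁻¹' S) := by
  intro X hX u hu Y hY hYS hXY
  refine h _ hX u ?_ _ (hT.isSubgroup_image hY) (by rintro _ ⟨y, hy, rfl⟩; exact hYS hy) ?_
  · rintro _ ⟨x, hx, rfl⟩
    exact hT.subset ((hT.conj_word_mem_iff u x).1 (hu x hx))
  · rintro _ ⟨_, ⟨x, hx, rfl⟩, rfl⟩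
    exact ⟨_, hXY ⟨x, hx, rfl⟩, hT.conj_eq (hu x hx)⟩

variable (hs : ∀ P ∈ Δ, G.IsSubgroup P)
include hs

theorem isSubgroup_of_mem {P : Set {f : M // [f] ∈ G.chainWords Δ}}
    (hP : Subtype.val '' P ∈ Δ) : T.IsSubgroup P := by
  have hPs := hs _ hP
  have hm : ∀ w : List {f : M // [f] ∈ G.chainWords Δ}, (∀ x ∈ w, x ∈ P) →
      ∀ x ∈ w.map Subtype.val, x ∈ Subtype.val '' P := fun w hw x hx => by
    obtain ⟨y, hy, rfl⟩ := List.mem_map.1 hx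
    exact ⟨y, hw y hy, rfl⟩
  have hw : ∀ w : List {f : M // [f] ∈ G.chainWords Δ}, (∀ x ∈ w, x ∈ P) → w ∈ T.D :=
    fun w hw => (hT.mem_iff w).2 (Chain.of_mem_subgroup hP hPs _ (hm w hw)).mem_chainWords
  refine ⟨hPs.nonempty.of_image, fun x hx => ?_, hw, fun w hwP => ?_⟩
  · obtain ⟨y, hy, e⟩ := hPs.inv_mem _ ⟨x, hx, rfl⟩
    rw [← hT.inv_eq] at e
    rwa [← Subtype.ext e]
  · obtain ⟨y, hy, e⟩ := hPs.prod_mem _ (hm w hwP)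
    rw [← hT.prod_eq w (hw w hwP)] at e
    rwa [← Subtype.ext e]

theorem chain_preimage {w : List {f : M // [f] ∈ G.chainWords Δ}} {H K : Set M} :
    G.Chain Δ (w.map Subtype.val) H K →
      T.Chain {P | Subtype.val '' P ∈ Δ} w (Subtype.val ⁻¹' H) (Subtype.val ⁻¹' K) := by
  intro h
  induction w generalizing H with
  | nil =>
    cases h with
    | nil h => exact .nil (by rwa [Set.mem_ofPred_eq, image_preimage_val hs h])
  | cons u w ih =>
    cases h with
    | @cons _ _ _ L _ h1 h2 h3 h4 =>
      -- Conjugability in `T` requires `(u, x, u⁻¹)` to be a chain word, not merely multipliable in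
      -- `G`. The loop from `H` to `L`, fixed there by `x`, and back to `H` shows this.
      have hc : T.Conjugable u (Subtype.val ⁻¹' L) := fun x hx => by
        rw [hT.conj_word_mem_iff]
        have h5 := Chain.single h1 h4.mem_left h2 h3
        exact (h5.append ((Chain.of_mem_subgroup h4.mem_left (hs _ h4.mem_left) [x.1]
          (by simpa using hx)).append h5.inv_single)).mem_chainWords
      refine .cons (by rwa [Set.mem_ofPred_eq, image_preimage_val hs h1]) hc ?_ (ih h4)
      refine Set.image_injective.2 Subtype.val_injective ?_
      rw [image_preimage_val hs h1, ← h3, Set.image_image]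
      conv_rhs => rw [← image_preimage_val hs h4.mem_left, Set.image_image]
      exact Set.image_congr fun x hx => hT.conj_eq (hc x hx)

theorem domain_eq : T.D = T.chainWords {P | Subtype.val '' P ∈ Δ} := by
  ext w
  rw [hT.mem_iff]
  refine ⟨fun h => ?_, fun h => ?_⟩
  · obtain ⟨H, K, h⟩ := Chain.of_mem_chainWords h
    exact (hT.chain_preimage hs h).mem_chainWords
  · obtain ⟨H, K, h⟩ := Chain.of_mem_chainWords h
    exact (hT.chain_map h).mem_chainWords

/-- The partial group of chain words of an overgroup closed collection is a locality. -/
theorem isLocality [Finite M] {p : ℕ} {S : Set M} (hS : G.IsPSubgroup p S) (hSΔ : S ∈ Δ)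
    (hsub : ∀ P ∈ Δ, P ⊆ S) (ho : G.OvergroupClosed Δ S)
    (hmax : ∀ Q, G.IsPSubgroup p Q → S ⊆ Q → Q = S) :
    T.IsLocality p {P | Subtype.val '' P ∈ Δ} (Subtype.val ⁻¹' S) := by
  have hST := image_preimage_val hs hSΔ
  have hS' : T.IsSubgroup (Subtype.val ⁻¹' S) :=
    hT.isSubgroup_of_mem hs (by rwa [hST])
  have hsub' : ∀ P ∈ {P : Set {f : M // [f] ∈ G.chainWords Δ} | Subtype.val '' P ∈ Δ},
      P ⊆ Subtype.val ⁻¹' S := fun P hP x hx => hsub _ hP ⟨x, hx, rfl⟩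
  have hd := hT.domain_eq hs
  refine ⟨inferInstance, ⟨hS', ?_⟩, hsub', by rwa [Set.mem_ofPred_eq, hST], ?_, fun Q hQ hSQ => ?_⟩
  · rw [← Set.ncard_image_of_injective _ Subtype.val_injective, hST]
    exact hS.card_eq
  · exact (hT.overgroupClosed ho).isObjective hd.ge
      (fun P hP => hT.isSubgroup_of_mem hs hP) hS' hsub' hd
  · refine Set.image_injective.2 Subtype.val_injective ?_
    rw [hST]
    refine hmax _ (hT.isPSubgroup_image hQ) ?_
    rw [← hST]
    exact Set.image_mono hSQ

end IsRestriction

end PartialGroup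

/-! ### Extensions of localities -/

namespace TwistingPair

open PartialGroup

variable {F B : Type*} {N : PartialGroup F} {Q : PartialGroup B} (E : TwistingPair N Q)

theorem conj_snd {u a : F × B} (h : [u, a, E.total.inv u] ∈ E.total.D) :
    [u.2, a.2, Q.inv u.2] ∈ Q.D ∧ (E.total.conj u a).2 = Q.conj u.2 a.2 := ⟨h.1, rfl⟩

/-- The cocycle leaves no trace: behind the base element `g`, the twisted letter of `(x, g)⁻¹` is
just `x⁻¹`, and cocycles with a unit argument are trivial. -/
theorem conj_incl {u : F × B} {y : F} (h : [u, E.incl y, E.total.inv u] ∈ E.total.D) :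
    [u.1, E.act u.2 y, N.inv u.1] ∈ N.D ∧
      E.total.conj u (E.incl y) = E.incl (N.conj u.1 (E.act u.2 y)) := by
  obtain ⟨x, g⟩ := u
  have p2 := Q.mul_inv_pair g
  have m3 : [g, Q.inv g, g] ∈ Q.D := by
    have := (Q.cancel_left [Q.inv g] [g] (Q.inv_mul_pair g).1).1
    simpa [invWord, Q.inv_inv] using this
  have e1 := E.twist_inverse_letter m3 x
  rw [p2.2, E.act_one, E.cocycle_one_left, N.mul_one] at e1
  have e : E.twist Q.one [(x, g), E.incl y, E.total.inv (x, g)] =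
      [x, E.act g y, N.inv x] := by
    simp only [twist, incl, E.act_one, E.cocycle_one_left, E.cocycle_one_right, N.mul_one,
      Q.one_mul, Q.mul_one]
    rw [← e1]
    rfl
  refine ⟨e ▸ h.2, Prod.ext ?_ ?_⟩
  · exact congrArg N.prod e
  · exact (Q.conj_one_right g).2

theorem base_map_incl (w : List F) :
    base (w.map E.incl) ∈ Q.D ∧ Q.prod (base (w.map E.incl)) = Q.one := by
  induction w with
  | nil => exact ⟨Q.nil_mem, rfl⟩
  | cons a w ih =>
    have := Q.insert_one [] _ ih.1
    exact ⟨this.1, this.2.trans ih.2⟩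

/-- Over the unit of the base, automorphism and cocycle are both trivial. Hence the fibre sits in
`L` with the same multipliable words and products. -/
theorem twist_map_incl (w : List F) : E.twist Q.one (w.map E.incl) = w := by
  induction w with
  | nil => rfl
  | cons a w ih =>
    simp only [List.map_cons, twist, incl, E.act_one, E.cocycle_one_left, N.mul_one, Q.mul_one]
    exact congrArg _ ih

theorem map_incl_mem (w : List F) : w.map E.incl ∈ E.total.D ↔ w ∈ N.D := by
  refine ⟨fun h => ?_, fun h => ⟨(E.base_map_incl w).1, ?_⟩⟩
  · rw [← E.twist_map_incl w]
    exact h.2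
  · rwa [E.twist_map_incl w]

theorem prod_map_incl (w : List F) : E.total.prod (w.map E.incl) = E.incl (N.prod w) :=
  Prod.ext (congrArg N.prod (E.twist_map_incl w)) (E.base_map_incl w).2

theorem inv_incl (x : F) : E.total.inv (E.incl x) = E.incl (N.inv x) := by
  have h := N.inv_mul_pair x
  refine (E.total.eq_inv_of_mul_eq_one ((E.map_incl_mem [N.inv x, x]).2 h.1) ?_).symm
  refine (E.prod_map_incl [N.inv x, x]).trans ?_
  exact (congrArg E.incl h.2).trans (E.prod_map_incl []).symm

theorem isSubgroup_preimage_incl {P : Set (F × B)} (hP : E.total.IsSubgroup P) :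
    N.IsSubgroup (E.incl ⁻¹' P) := by
  have hw : ∀ w : List F, (∀ x ∈ w, x ∈ E.incl ⁻¹' P) → ∀ a ∈ w.map E.incl, a ∈ P :=
    fun w hw a ha => by
      obtain ⟨x, hx, rfl⟩ := List.mem_map.1 ha
      exact hw x hx
  refine ⟨⟨N.one, ?_⟩, fun x hx => ?_, fun w h => ?_, fun w h => ?_⟩
  · exact hP.one_mem
  · rw [Set.mem_preimage, ← E.inv_incl]
    exact hP.inv_mem _ hx
  · exact (E.map_incl_mem w).1 (hP.word_mem _ (hw w h))
  · rw [Set.mem_preimage, ← E.prod_map_incl]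
    exact hP.prod_mem _ (hw w h)

theorem isSubgroup_image_proj {P : Set (F × B)} (hP : E.total.IsSubgroup P) :
    Q.IsSubgroup (E.proj '' P) := by
  have hw : ∀ w : List B, (∀ g ∈ w, g ∈ E.proj '' P) →
      ∃ v : List (F × B), (∀ a ∈ v, a ∈ P) ∧ base v = w := fun w hw => by
    induction w with
    | nil => exact ⟨[], by simp, rfl⟩
    | cons g w ih =>
      obtain ⟨v, hv, rfl⟩ := ih fun x hx => hw x (by simp [hx])
      obtain ⟨a, ha, rfl⟩ := hw g (by simp)
      exact ⟨a :: v, by simpa using ⟨ha, fun x y => hv (x, y)⟩, rfl⟩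
  refine ⟨hP.nonempty.image _, ?_, fun w h => ?_, fun w h => ?_⟩
  · rintro _ ⟨a, ha, rfl⟩
    exact ⟨_, hP.inv_mem a ha, rfl⟩
  · obtain ⟨v, hv, rfl⟩ := hw w h
    exact (hP.word_mem v hv).1
  · obtain ⟨v, hv, rfl⟩ := hw w h
    exact ⟨_, hP.prod_mem v hv, rfl⟩

theorem conj_image_proj (u : F × B) (K : Set (F × B)) :
    Q.conj u.2 '' (E.proj '' K) = E.proj '' (E.total.conj u '' K) := by
  rw [Set.image_image, Set.image_image]
  rfl

section Conjugable

variable {E} {u : F × B} {K : Set (F × B)} (hc : E.total.Conjugable u K)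
include hc

theorem conjugable_proj : Q.Conjugable u.2 (E.proj '' K) := by
  rintro _ ⟨a, ha, rfl⟩
  exact (E.conj_snd (hc a ha)).1

/-- The fibre is normal: an element of `K` whose conjugate lies in the fibre has base component
conjugate to the unit, hence equal to it. So intersecting with the fibre commutes with conjugation.
-/
theorem conj_preimage_incl :
    (fun y => N.conj u.1 (E.act u.2 y)) '' (E.incl ⁻¹' K) =
      E.incl ⁻¹' (E.total.conj u '' K) := by
  ext z
  constructor
  · rintro ⟨y, hy, rfl⟩
    exact ⟨_, hy, (E.conj_incl (hc _ hy)).2⟩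
  · rintro ⟨a, ha, e⟩
    have h1 := E.conj_snd (hc a ha)
    have h2 : Q.conj u.2 a.2 = Q.one := h1.2.symm.trans (congrArg Prod.snd e)
    have h3 : a.2 = Q.one := by
      rw [← (conj_inv_conj h1.1).2, h2, (Q.conj_one_right _).2]
    obtain ⟨y, g⟩ := a
    obtain rfl : g = Q.one := h3
    refine ⟨y, ha, ?_⟩
    have := (E.conj_incl (hc _ ha)).2.symm.trans e
    exact congrArg Prod.fst this

end Conjugable

/-! ### Isotypical extensions: multipliability, overgroup closure, maximality -/

section Isotypical

variable {E} {p : ℕ} {Δ₁ : Set (Set F)} {S₁ : Set F} {Δ₂ : Set (Set B)} {S₂ : Set B}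
  {S : Set (F × B)}

theorem IsSubextension.mem_objects_iff (hS : E.IsSubextension p S₁ S₂ S) {P : Set (F × B)} :
    P ∈ E.objects S₁ Δ₁ Δ₂ S ↔
      E.total.IsSubgroup P ∧ P ⊆ S ∧ E.incl ⁻¹' P ∈ Δ₁ ∧ E.proj '' P ∈ Δ₂ := by
  refine and_congr_right fun _ => and_congr_right fun h => ?_
  have e : {x ∈ S₁ | E.incl x ∈ P} = E.incl ⁻¹' P := by
    ext x
    exact ⟨fun hx => hx.2, fun hx => ⟨(hS.incl_mem_iff x).1 (h hx), hx⟩⟩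
  rw [e]

theorem chain_proj (hS : E.IsSubextension p S₁ S₂ S) {w : List (F × B)} {H R : Set (F × B)}
    (h : E.total.Chain (E.objects S₁ Δ₁ Δ₂ S) w H R) :
    Q.Chain Δ₂ (base w) (E.proj '' H) (E.proj '' R) := by
  induction h with
  | nil h => exact .nil (hS.mem_objects_iff.1 h).2.2.2
  | cons h1 h2 h3 _ ih =>
    refine .cons (hS.mem_objects_iff.1 h1).2.2.2 (conjugable_proj h2) ?_ ih
    rw [E.conj_image_proj, h3]

/-- The twisted word of a chain word is, up to elements of the normalizer, a chain word. -/
theorem IsIsotypical.exists_gauge (hE : E.IsIsotypical Δ₁ S₁) (hS : E.IsSubextension p S₁ S₂ S)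
    {w : List (F × B)} {H R : Set (F × B)}
    (h : E.total.Chain (E.objects S₁ Δ₁ Δ₂ S) w H R) (k : B) (hk : k :: base w ∈ Q.D)
    {Φ : N.Aut} (hΦ : Φ '' S₁ = S₁) {n : F} (hn : n ∈ N.normalizer)
    (hact : ∀ x, E.act k x = N.conj n (Φ x)) :
    ∃ A K m, N.Chain Δ₁ A (Φ '' (E.incl ⁻¹' H)) K ∧ Gauge N (N.inv n) m A (E.twist k w) := by
  induction h generalizing k Φ n with
  | nil h =>
    exact ⟨[], _, _, .nil (hE.invariant Φ hΦ _ (hS.mem_objects_iff.1 h).2.2.1), .nil _⟩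
  | @cons u w H K R h1 h2 h3 h4 ih =>
    -- The tail of the word is twisted starting from `kg`, so the induction continues with a
    -- decomposition of `Ψ_{kg}`.
    obtain ⟨Ψ, hΨ, m, hm, hmact⟩ := hE.outer (Q.mul k u.2)
    have hku : [k, u.2] ∈ Q.D := Q.left_mem (v := base w) hk
    obtain ⟨A, K', f, hA, hg⟩ := ih (Q.mul k u.2) (Q.merge_head [k, u.2] (base w) hk).1 hΨ hm hmact
    have hη := E.cocycle_mem _ _ hku
    have hn' := inv_mem_normalizer hn
    -- With `u = (x, g)`, the corrected letter is `n⁻¹ · Ψ_k(x) η(k, g) · m`. Conjugating by its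
    -- factors from the right, `m` turns `Ψ(y)` into `Ψ_{kg}(y)`, then `η(k, g)` gives
    -- `Ψ_k(Ψ_g(y))`, then `Ψ_k(x)` gives `Ψ_k(x Ψ_g(y) x⁻¹)`, and `n⁻¹` replaces the outer `Ψ_k` by
    -- `Φ`.
    have key : ∀ y ∈ E.incl ⁻¹' K,
        [N.mul (N.inv n) (N.mul (N.mul (E.act k u.1) (E.cocycle k u.2)) m), Ψ y,
          N.inv (N.mul (N.inv n) (N.mul (N.mul (E.act k u.1) (E.cocycle k u.2)) m))] ∈ N.D ∧
        N.conj (N.mul (N.inv n) (N.mul (N.mul (E.act k u.1) (E.cocycle k u.2)) m)) (Ψ y) =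
          Φ (N.conj u.1 (E.act u.2 y)) := by
      intro y hy
      have c0 := (E.conj_incl (h2 _ hy)).1
      have c1 := (E.act k).mapMem c0
      rw [List.map_cons, List.map_cons, List.map_singleton, (E.act k).map_inv] at c1
      have c2 := E.conj_eq _ _ hku y
      have d1 := conj_mul_right hη (x := E.act k u.1) (by rw [c2]; exact c1)
      have d2 := conj_mul_right hm (y := Ψ y) (by rw [← hmact]; exact d1.1)
      have d3 := conj_mul_left hn' d2.1
      refine ⟨d3.1, ?_⟩
      rw [d3.2, d2.2, ← hmact, d1.2, c2, ← (E.act k).map_conj c0, hact, conj_conj hn]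
    refine ⟨N.mul (N.inv n) (N.mul (N.mul (E.act k u.1) (E.cocycle k u.2)) m) :: A, K', f,
      .cons (hE.invariant Φ hΦ _ (hS.mem_objects_iff.1 h1).2.2.1) ?_ ?_ hA, .cons (inv_mem_normalizer hm) ?_ hg⟩
    · rintro _ ⟨y, hy, rfl⟩
      exact (key y hy).1
    · rw [← h3, ← conj_preimage_incl h2, Set.image_image, Set.image_image]
      exact Set.image_congr fun y hy => (key y hy).2
    · rw [N.inv_inv]
      exact (N.prod_cons _ _ (mem_mxn hn' hm _)).2

variable (h₁ : N.IsLocality p Δ₁ S₁) (h₂ : Q.IsLocality p Δ₂ S₂)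
include h₁ h₂

theorem IsIsotypical.chainWords_subset (hE : E.IsIsotypical Δ₁ S₁)
    (hS : E.IsSubextension p S₁ S₂ S) :
    E.total.chainWords (E.objects S₁ Δ₁ Δ₂ S) ⊆ E.total.D := by
  intro w hw
  obtain ⟨H, R, h⟩ := Chain.of_mem_chainWords hw
  have hb : base w ∈ Q.D := h₂.isObjective.domain_eq ▸ (chain_proj hS h).mem_chainWords
  obtain ⟨Φ, hΦ, n, hn, hact⟩ := hE.outer Q.one
  obtain ⟨A, K, m, hA, hg⟩ := hE.exists_gauge hS h Q.one (Q.insert_one [] _ hb).1 hΦ hn hact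
  have hAD : A ∈ N.D := h₁.isObjective.domain_eq ▸ hA.mem_chainWords
  have hn' := inv_mem_normalizer hn
  -- The gauge relation is used backwards: the corrected word `A` is multipliable, so the original
  -- twisted word is too.
  exact ⟨hb, ((hg.symm hn').mem_of_mem (inv_mem_normalizer hn') hAD).1⟩

theorem IsIsotypical.overgroupClosed (hp : p.Prime) (hE : E.IsIsotypical Δ₁ S₁)
    (hS : E.IsSubextension p S₁ S₂ S) :
    E.total.OvergroupClosed (E.objects S₁ Δ₁ Δ₂ S) S := by
  intro X hX u hu Y hY hYS hXY
  obtain ⟨-, -, hX1, hX2⟩ := hS.mem_objects_iff.1 hX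
  refine hS.mem_objects_iff.2 ⟨hY, hYS, ?_, ?_⟩
  -- For `u = (x, g)`, conjugation by `u` acts on the fibre as `Φ` followed by conjugation by `xn`.
  -- Hence `Y ∩ S'` contains a conjugate of `Φ(X ∩ S')`, which is in `Δ'`.
  · obtain ⟨Φ, hΦ, n, hn, hact⟩ := hE.outer u.2
    have key : ∀ y ∈ E.incl ⁻¹' X, [N.mul u.1 n, Φ y, N.inv (N.mul u.1 n)] ∈ N.D ∧
        N.conj (N.mul u.1 n) (Φ y) = N.conj u.1 (E.act u.2 y) := fun y hy => by
      rw [hact]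
      exact conj_mul_right hn (by rw [← hact]; exact (E.conj_incl (hu _ hy)).1)
    refine h₁.overgroupClosed hp _ (hE.invariant Φ hΦ _ hX1) (N.mul u.1 n) ?_ _
      (E.isSubgroup_preimage_incl hY) (fun x hx => (hS.incl_mem_iff x).1 (hYS hx)) ?_
    · rintro _ ⟨y, hy, rfl⟩
      exact (key y hy).1
    · rw [Set.image_image, Set.image_congr fun y hy => (key y hy).2, conj_preimage_incl hu]
      exact Set.preimage_mono hXY
  · refine h₂.overgroupClosed hp _ hX2 u.2 (conjugable_proj hu) _ (E.isSubgroup_image_proj hY) ?_ ?_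
    · rw [← hS.proj_image]
      exact Set.image_mono hYS
    · rw [E.conj_image_proj]
      exact Set.image_mono hXY

theorem IsSubextension.maximal (hp : p.Prime) (hS : E.IsSubextension p S₁ S₂ S)
    {P : Set (F × B)} (hP : E.total.IsPSubgroup p P) (hSP : S ⊆ P) : P = S := by
  have hPs := hP.toIsSubgroup
  have hPi := E.isSubgroup_preimage_incl hPs
  have hPp := E.isSubgroup_image_proj hPs
  have e1 : E.incl ⁻¹' P = S₁ := by
    refine h₁.maximal _ (hP.of_ncard_dvd hp hPi (hPi.ncard_dvd_of_injOn hPs E.incl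
      (fun x hx => hx) (fun x _ y _ => (E.prod_map_incl [x, y]).symm)
      fun x _ y _ hxy => congrArg Prod.fst hxy)) fun x hx => hSP ((hS.incl_mem_iff x).2 hx)
  have e2 : E.proj '' P = S₂ := by
    refine h₂.maximal _ (hP.of_ncard_dvd hp hPp (hPs.ncard_dvd_of_surjOn hPp E.proj rfl
      fun x _ y _ => rfl)) ?_
    rw [← hS.proj_image]
    exact Set.image_mono hSP
  refine Set.Subset.antisymm (fun a ha => ?_) hSP
  -- As `P` and `S` have the same image, some `s ∈ S` has the base component of `a`. Then `a s⁻¹`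
  -- lies in the fibre part of `P`, which is that of `S`, so `a = (a s⁻¹) s ∈ S`.
  obtain ⟨s, hs, hsa⟩ : E.proj a ∈ E.proj '' S := by
    rw [hS.proj_image, ← e2]
    exact ⟨a, ha, rfl⟩
  have hsP := hSP hs
  have hsi := hPs.inv_mem s hsP
  have hr := hPs.mul_mem ha hsi
  have hr2 : (E.total.mul a (E.total.inv s)).2 = Q.one := by
    have : (E.total.mul a (E.total.inv s)).2 = Q.mul (E.proj a) (Q.inv (E.proj s)) := rfl
    rw [this, hsa]
    exact (Q.mul_inv_pair _).2
  have hre : E.total.mul a (E.total.inv s) = E.incl (E.total.mul a (E.total.inv s)).1 :=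
    Prod.ext rfl hr2
  have hrS : E.total.mul a (E.total.inv s) ∈ S := by
    rw [hre, hS.incl_mem_iff, ← e1, Set.mem_preimage, ← hre]
    exact hr
  have := hS.isPSubgroup.toIsSubgroup.mul_mem hrS hs
  rwa [E.total.mul_assoc (hPs.word_mem _ (by simp [ha, hsi, hsP])), (E.total.inv_mul_pair s).2,
    E.total.mul_one] at this

end Isotypical

end TwistingPair

theorem mainTheorem12 {p : ℕ} (hp : p.Prime) {F B : Type*}
    (L₁ : PartialGroup F) (Δ₁ : Set (Set F)) (S₁ : Set F) (h₁ : L₁.IsLocality p Δ₁ S₁)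
    (L₂ : PartialGroup B) (Δ₂ : Set (Set B)) (S₂ : Set B) (h₂ : L₂.IsLocality p Δ₂ S₂)
    (E : TwistingPair L₁ L₂) (hE : E.IsIsotypical Δ₁ S₁)
    (S : Set (F × B)) (hS : E.IsSubextension p S₁ S₂ S)
    (Δ : Set (Set (F × B))) (hΔ : Δ = E.objects S₁ Δ₁ Δ₂ S) :
    ∃ T : PartialGroup {f : F × B // [f] ∈ E.total.chainWords Δ},
      E.total.IsRestriction (E.total.chainWords Δ) T ∧
      (∀ s ∈ S, [s] ∈ E.total.chainWords Δ) ∧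
      T.IsLocality p {P | Subtype.val '' P ∈ Δ} (Subtype.val ⁻¹' S) := by
  subst hΔ
  have := h₁.finite
  have := h₂.finite
  have hsg : ∀ P ∈ E.objects S₁ Δ₁ Δ₂ S, E.total.IsSubgroup P := fun P hP => hP.1
  have hSs := hS.isPSubgroup.toIsSubgroup
  have hSΔ : S ∈ E.objects S₁ Δ₁ Δ₂ S := by
    have e : E.incl ⁻¹' S = S₁ := Set.ext hS.incl_mem_iff
    refine hS.mem_objects_iff.2 ⟨hSs, subset_rfl, ?_, ?_⟩
    · rw [e]
      exact h₁.mem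
    · rw [hS.proj_image]
      exact h₂.mem
  have hT := PartialGroup.isRestriction_restriction ⟨S, hSΔ⟩ (hE.chainWords_subset h₁ h₂ hS) hsg
  refine ⟨_, hT, fun s hs => ?_, ?_⟩
  · exact (PartialGroup.Chain.of_mem_subgroup hSΔ hSs [s] (by simpa using hs)).mem_chainWords
  · exact hT.isLocality hsg hS.isPSubgroup hSΔ (fun P hP => hP.2.1)
      (hE.overgroupClosed h₁ h₂ hp hS) fun P hP hSP => hS.maximal h₁ h₂ hp hP hSP
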